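/- Let $H$ be a separable infinite-dimensional complex Hilbert space with a fixed orthonormal basis $(e_n)_{n\ge 1}$. Let $\mathscr D$ be the algebra of bounded operators on $H$ that are diagonal in this basis, and for $T\in B(H)$ let $E(T)\in\mathscr D$ be the diagonal operator with the same main diagonal as $T$, i.e. $E(T)e_n=\langle Te_n,e_n\rangle e_n$. Let $K(H)^+$ be the set of positive compact operators and $\mathscr L_1$ the trace class. For compact $T$ let $s(T)=(s_1(T),s_2(T),\dots)$ be the sequence of singular numbers of $T$: the positive eigenvalues of $(T^*T)^{1/2}$ in nonincreasing order, repeated according to multiplicity, followed by zeros if there are only finitely many. For nonincreasing sequences $\xi,\eta$ of nonnegative reals converging to $0$, write $\xi\prec\eta$ if $\sum_{j=1}^n\xi_j\le\sum_{j=1}^n\eta_j$ for every $n$, and $\xi\preccurlyeq\eta$ ($\eta$ strongly majorizes $\xi$) if moreover $\liminf_{n\to\infty}\sum_{j=1}^n(\eta_j-\xi_j)=0$. For $A\in B(H)$ let $$\mathscr V(A)=\{VAV^*\mid V\in B(H)\text{ a partial isometry with }V^*V=R_A\vee R_{A^*}\},$$ where $R_T$ denotes the orthogonal projection onto the closure of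 the range of $T$ and $P\vee Q$ the projection onto the closed span of the ranges of $P$ and $Q$. **Proposition 6.4.** Let $A\in K(H)^+$. Then $$E(\mathscr V(A))=\begin{cases}\{B\in\mathscr D\cap K(H)^+\mid s(B)\prec s(A)\}\setminus\mathscr L_1&\text{if }\operatorname{tr}(A)=\infty,\\[2pt]\{B\in\mathscr D\cap K(H)^+\mid s(B)\preccurlyeq s(A)\}&\text{if }\operatorname{tr}(A)<\infty.\end{cases}$$ -/

import Mathlib

open scoped ENNReal InnerProductSpace

noncomputable section

namespace SchurHorn

/-! ### Majorization of sequences (indexed from `0`) -/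

/-- `ξ ≺ η`: the partial sums of `ξ` are dominated by those of `η`. -/
def Majorized (ξ η : ℕ → ℝ) : Prop :=
  ∀ n : ℕ, ∑ j ∈ Finset.range n, ξ j ≤ ∑ j ∈ Finset.range n, η j

/-- `ξ ≼ η`: `ξ ≺ η` and `liminf ∑_{j < n} (η j - ξ j) = 0`. The lower limit is taken in the
extended reals, so that it has its usual value also for unbounded partial sums. -/
def StronglyMajorized (ξ η : ℕ → ℝ) : Prop :=
  Majorized ξ η ∧
    Filter.liminf (fun n : ℕ => ((∑ j ∈ Finset.range n, (η j - ξ j) : ℝ) : EReal))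
      Filter.atTop = 0

variable {H : Type*} [NormedAddCommGroup H] [InnerProductSpace ℂ H]

/-! ### Diagonal operators and the conditional expectation -/

/-- The diagonal operator `diag ρ`, `e n ↦ ρ n • e n`, for a bounded sequence `ρ`. -/
def diag (e : HilbertBasis ℕ ℂ H) (ρ : lp (fun _ : ℕ => ℂ) ∞) : H →L[ℂ] H :=
  (e.repr.symm : lp (fun _ : ℕ => ℂ) 2 →L[ℂ] H) ∘L
    (lp.mapCLM 2 (fun i => ρ i • ContinuousLinearMap.id ℂ ℂ) (norm_nonneg ρ)
      (fun i => by
        simpa [norm_smul] using lp.norm_apply_le_norm ENNReal.top_ne_zero ρ i)) ∘L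
    (e.repr : H →L[ℂ] lp (fun _ : ℕ => ℂ) 2)

/-- The masa `𝒟` of operators that are diagonal with respect to the basis `e`. -/
def diagonalOperators (e : HilbertBasis ℕ ℂ H) : Set (H →L[ℂ] H) :=
  Set.range (diag e)

theorem memℓp_mainDiagonal (e : HilbertBasis ℕ ℂ H) (T : H →L[ℂ] H) :
    Memℓp (fun n : ℕ => ⟪e n, T (e n)⟫_ℂ) ∞ := by
  refine memℓp_infty ⟨‖T‖, ?_⟩
  rintro _ ⟨n, rfl⟩
  have h1 : ‖e n‖ = 1 := e.orthonormal.1 n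
  calc ‖⟪e n, T (e n)⟫_ℂ‖ ≤ ‖e n‖ * ‖T (e n)‖ := norm_inner_le_norm _ _
    _ ≤ ‖e n‖ * (‖T‖ * ‖e n‖) := by gcongr; exact T.le_opNorm _
    _ = ‖T‖ := by rw [h1]; ring

/-- The main diagonal `⟨T e_n, e_n⟩` of an operator, as a bounded sequence. -/
def mainDiagonal (e : HilbertBasis ℕ ℂ H) (T : H →L[ℂ] H) : lp (fun _ : ℕ => ℂ) ∞ :=
  ⟨fun n => ⟪e n, T (e n)⟫_ℂ, memℓp_mainDiagonal e T⟩

/-- The conditional expectation `E : B(H) → 𝒟`: `E T` is the diagonal operator with the same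
main diagonal as `T`. -/
def expectation (e : HilbertBasis ℕ ℂ H) (T : H →L[ℂ] H) : H →L[ℂ] H :=
  diag e (mainDiagonal e T)

theorem diag_apply_basis (e : HilbertBasis ℕ ℂ H) (ρ : lp (fun _ : ℕ => ℂ) ∞) (n : ℕ) :
    diag e ρ (e n) = ρ n • e n := by
  apply e.repr.injective
  ext i
  have h : (e.repr (e n) : ℕ → ℂ) i = if i = n then 1 else 0 := by
    rw [e.repr_apply_apply, orthonormal_iff_ite.mp e.orthonormal]
  by_cases hi : i = n <;> simp [diag, h, hi]

variable [CompleteSpace H]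

/-! ### Compact operators, trace, singular numbers -/

/-- The positive cone `K(H)⁺` of the compact operators. -/
def positiveCompacts (H : Type*) [NormedAddCommGroup H] [InnerProductSpace ℂ H]
    [CompleteSpace H] : Set (H →L[ℂ] H) :=
  {T | IsCompactOperator T ∧ T.IsPositive}

/-- The trace, in `[0, ∞]`, of a positive operator (computed, as usual, in an orthonormal
basis). -/
def trace (e : HilbertBasis ℕ ℂ H) (T : H →L[ℂ] H) : ℝ≥0∞ :=
  ∑' n : ℕ, ENNReal.ofReal (⟪e n, T (e n)⟫_ℂ).re

/-- The trace class `ℒ₁`: operators `T` such that `|T| = (T* T)^{1/2}` has finite trace. -/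
def traceClass (e : HilbertBasis ℕ ℂ H) : Set (H →L[ℂ] H) :=
  {T | trace e (CFC.abs T) < ∞}

/-- The number, with multiplicity, of eigenvalues of `|T| = (T* T)^{1/2}` that are at least `t`,
i.e. the dimension of the (direct) sum of the corresponding eigenspaces. It is finite when `T`
is compact and `t > 0`. -/
def eigenvalueCount (T : H →L[ℂ] H) (t : ℝ) : ℕ :=
  Module.finrank ℂ
    (⨆ μ ∈ Set.Ici t,
      Module.End.eigenspace ((CFC.abs T : H →L[ℂ] H) : H →ₗ[ℂ] H) (μ : ℂ) : Submodule ℂ H)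

/-- The sequence `s(T)` of singular numbers of a compact operator `T`: the positive eigenvalues
of `|T| = (T* T)^{1/2}` in nonincreasing order, repeated according to multiplicity, followed by
zeros if there are only finitely many. The term of index `n` (from `0`) is the largest `t > 0`
such that more than `n` eigenvalues, counted with multiplicity, are at least `t`, and it is `0`
(the supremum of the empty set) if `|T|` has at most `n` positive eigenvalues. -/
def singularNumbers (T : H →L[ℂ] H) (n : ℕ) : ℝ :=
  sSup {t : ℝ | 0 < t ∧ n < eigenvalueCount T t}

/-! ### The partial isometry orbit -/

/-- `V` is a partial isometry: it is isometric on the orthogonal complement of its kernel. -/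
def IsPartialIsometry (V : H →L[ℂ] H) : Prop :=
  ∀ x ∈ (LinearMap.ker (V : H →ₗ[ℂ] H))ᗮ, ‖V x‖ = ‖x‖

/-- The projection `R_T ∨ R_{T*}` onto the closed span of the ranges of `T` and `T*`. -/
def rangeProjectionSup (T : H →L[ℂ] H) : H →L[ℂ] H :=
  (LinearMap.range (T : H →ₗ[ℂ] H) ⊔
    LinearMap.range (ContinuousLinearMap.adjoint T : H →ₗ[ℂ] H)).topologicalClosure.starProjection

/-- The partial isometry orbit
`𝒱(T) = {V T V* | V a partial isometry with V* V = R_T ∨ R_{T*}}`. -/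
def partialIsometryOrbit (T : H →L[ℂ] H) : Set (H →L[ℂ] H) :=
  {S | ∃ V : H →L[ℂ] H, IsPartialIsometry V ∧
    ContinuousLinearMap.adjoint V ∘L V = rangeProjectionSup T ∧
    S = V ∘L T ∘L ContinuousLinearMap.adjoint V}

end SchurHorn

end

/-!
The Schur–Horn theorem for a positive compact operator `A` and its partial isometry orbit.

Both inclusions are read off an eigenbasis `b` of `A`, with eigenvalues `μ` and an injection `σ`
that lists the positive ones in decreasing order, so that the singular numbers of `A` are `μ ∘ σ`
(`exists_eigenbasis`, `exists_sort`, `singularNumbers_eq`); for a diagonal operator the basis `e`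
plays the role of `b`.

*Necessity* (`expectation_mem`). The diagonal of `V A V*` is `∑ k, μ k |⟨V b_k, e_n⟩|²`. Its partial
sums are dominated by Ky Fan's inequality (`sum_re_inner_le`), and its total sum is the trace of
`A`, since `V` is isometric on the range of `A` (`tsum_ofReal_conj`). If the trace is finite, equality
of the total sums is the same as the vanishing of the lower limit.

*Sufficiency* (`mem_expectation_image`). It suffices to find an orthonormal sequence `g` with
`⟨A g_j, g_j⟩ = d_j`, where `d` is the given decreasing sequence, that is complete modulo the kernel
of `A` (`Stage.exists_orthonormal`): a partial isometry then moves `g` to the basis `e`. Start with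
the eigenvectors. At stage `n` the values `w_j = ⟨A v_j, v_j⟩` dominate `d` and agree with it for
`j < n`. A rotation of `v_n` and `v_k`, where `k` is the first index beyond `n` with `w_k ≤ d_n`,
changes `w_n` into `d_n` and moves the surplus `w_n - d_n` to the index `k`, and the majorization
persists (`Stage.step`). At stage `m` the compression of `A` to the orthogonal complement of the
final vectors is diagonal, and its entries are at most `sup_{k ≥ m} w_k` plus the total surplus
`∑_{j < m} (w_j - d_j)` of the original values. Hence the limit sequence is complete modulo the
kernel of `A` as soon as the surplus is small at infinitely many indices `m`. If `d` is summable, this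
is strong majorization. Otherwise it can be arranged by a permutation of the vectors that have not
been used: postponing a block of them behind sufficiently many vectors with tiny values uses up the
surplus, and the majorization survives if the block starts at an index at which the surplus is
almost minimal among all later ones (`exists_perm_surplus_le`).
-/

open Filter Topology

/-! ### Rearrangements of sequences -/

namespace SchurHorn

/-- A nonnegative null sequence is listed in decreasing order by an injection, which may skip zeros
only. If there are finitely many positive terms, the list goes on with zeros. -/
theorem exists_sort {d : ℕ → ℝ} (h0 : ∀ n, 0 ≤ d n) (hd : Tendsto d atTop (𝓝 0)) :
    ∃ σ : ℕ → ℕ, Function.Injective σ ∧ Antitone (d ∘ σ) ∧ ∀ n, n ∉ Set.range σ → d n = 0 := by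
  have hmax : ∀ F : Finset ℕ, ∃ m, m ∉ F ∧ ∀ k, k ∉ F → d k ≤ d m := by
    intro F
    by_cases hF : ∃ k, k ∉ F ∧ 0 < d k
    · obtain ⟨k, hkF, hk⟩ := hF
      obtain ⟨N, hN⟩ := eventually_atTop.1 (hd.eventually (gt_mem_nhds hk))
      have hkN : k < N := by
        by_contra hcon
        exact lt_irrefl _ (hN k (not_lt.1 hcon))
      obtain ⟨m, hm, hmax⟩ := ((Finset.range N).filter (· ∉ F)).exists_max_image d
        ⟨k, by simp [hkN, hkF]⟩
      simp only [Finset.mem_filter, Finset.mem_range] at hm hmax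
      refine ⟨m, hm.2, fun l hl => ?_⟩
      rcases lt_or_ge l N with h | h
      · exact hmax l ⟨h, hl⟩
      · exact (hN l h).le.trans (hmax k ⟨hkN, hkF⟩)
    · push Not at hF
      obtain ⟨m, hm⟩ := Infinite.exists_notMem_finset F
      exact ⟨m, hm, fun k hk => (hF k hk).trans (h0 m)⟩
  choose pick hpick hle using hmax
  let F : ℕ → Finset ℕ := fun n => Nat.rec ∅ (fun _ G => insert (pick G) G) n
  have hF : ∀ n, F (n + 1) = insert (pick (F n)) (F n) := fun n => rfl
  have hmono : Monotone F := monotone_nat_of_le_succ fun n => by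
    rw [hF]; exact Finset.subset_insert _ _
  have hmem : ∀ {m n}, m < n → pick (F m) ∈ F n := fun {m n} h =>
    hmono (Nat.succ_le_of_lt h) (by rw [hF]; exact Finset.mem_insert_self _ _)
  have hinj : Function.Injective fun n => pick (F n) := by
    intro m n h
    rcases lt_trichotomy m n with hmn | hmn | hmn
    · exact absurd (hmem hmn) (by simpa only [h] using hpick (F n))
    · exact hmn
    · exact absurd (hmem hmn) (by simpa only [← h] using hpick (F m))
  have hsub : ∀ n, ∀ k ∈ F n, ∃ j, pick (F j) = k := by
    intro n
    induction n with
    | zero => intro k hk; simp [F] at hk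
    | succ n ih =>
      intro k hk
      rw [hF, Finset.mem_insert] at hk
      rcases hk with rfl | hk
      · exact ⟨n, rfl⟩
      · exact ih k hk
  refine ⟨fun n => pick (F n), hinj, antitone_nat_of_succ_le fun n => ?_, fun n hn => ?_⟩
  · exact hle _ _ fun h => hpick (F (n + 1)) (hmono n.le_succ h)
  · refine le_antisymm ?_ (h0 n)
    have ht : Tendsto (fun k => d (pick (F k))) atTop (𝓝 0) := by
      have := hinj.tendsto_cofinite
      rw [Nat.cofinite_eq_atTop] at this
      exact hd.comp this
    exact ge_of_tendsto' ht fun k => hle _ _ fun h => hn (hsub k n h)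

/-- A nonnegative sequence has arbitrarily late indices at which it is, up to `ε`, as small as at
all later ones. -/
theorem exists_almost_min {δ : ℕ → ℝ} (h0 : ∀ m, 0 ≤ δ m) {ε : ℝ} (hε : 0 < ε) (N : ℕ) :
    ∃ m₀ ≥ N, ∀ m ≥ m₀, δ m₀ ≤ δ m + ε := by
  have hbdd : BddBelow (δ '' Set.Ici N) := ⟨0, by rintro _ ⟨m, _, rfl⟩; exact h0 m⟩
  obtain ⟨_, ⟨m₀, hm₀, rfl⟩, hlt⟩ := exists_lt_of_csInf_lt
    (Set.Nonempty.image δ ⟨N, Set.self_mem_Ici⟩) (lt_add_of_pos_right (sInf (δ '' Set.Ici N)) hε)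
  refine ⟨m₀, hm₀, fun m hm => hlt.le.trans ?_⟩
  gcongr
  exact csInf_le hbdd ⟨m, le_trans hm₀ hm, rfl⟩

/-- The permutation of `ℕ` that moves the block `[K, K + t)` in front of the block `[m, K)`. -/
def blockMove (m K t : ℕ) (hmK : m ≤ K) : Equiv.Perm ℕ where
  toFun j := if j < m then j else if j < m + t then j - m + K else if j < K + t then j - t else j
  invFun j := if j < m then j else if j < K then j + t else if j < K + t then j - K + m else j
  left_inv j := by dsimp only; split_ifs <;> omega
  right_inv j := by dsimp only; split_ifs <;> omega

section blockMove

variable {m K t : ℕ} (hmK : m ≤ K) (w : ℕ → ℝ)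

theorem blockMove_apply (j : ℕ) : blockMove m K t hmK j =
    if j < m then j else if j < m + t then j - m + K else if j < K + t then j - t else j := rfl

/-! The partial sums of `w ∘ blockMove m K t`, up to an index before, in, or behind the moved
blocks. -/

theorem sum_blockMove_of_le {n : ℕ} (hn : n ≤ m) :
    ∑ j ∈ Finset.range n, w (blockMove m K t hmK j) = ∑ j ∈ Finset.range n, w j := by
  refine Finset.sum_congr rfl fun j hj => ?_
  rw [blockMove_apply, if_pos (by have := Finset.mem_range.1 hj; omega)]

theorem sum_blockMove_front {i : ℕ} (hi : i ≤ t) :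
    ∑ j ∈ Finset.range (m + i), w (blockMove m K t hmK j) =
      ∑ j ∈ Finset.range m, w j + ∑ l ∈ Finset.range i, w (l + K) := by
  rw [Finset.sum_range_add, sum_blockMove_of_le hmK w le_rfl]
  congr 1
  refine Finset.sum_congr rfl fun l hl => ?_
  have := Finset.mem_range.1 hl
  rw [blockMove_apply, if_neg (by omega), if_pos (by omega)]
  congr 1; omega

theorem sum_blockMove_middle {n : ℕ} (hmn : m ≤ n) (hn : n ≤ K) :
    ∑ j ∈ Finset.range (n + t), w (blockMove m K t hmK j) =
      ∑ j ∈ Finset.range n, w j + ∑ l ∈ Finset.range t, w (l + K) := by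
  induction n, hmn using Nat.le_induction with
  | base => exact sum_blockMove_front hmK w le_rfl
  | succ n hmn ih =>
    rw [Nat.succ_add, Finset.sum_range_succ, ih (by omega), Finset.sum_range_succ, blockMove_apply,
      if_neg (by omega), if_neg (by omega), if_pos (by omega), Nat.add_sub_cancel]
    ring

theorem sum_blockMove_of_ge {n : ℕ} (hn : K + t ≤ n) :
    ∑ j ∈ Finset.range n, w (blockMove m K t hmK j) = ∑ j ∈ Finset.range n, w j := by
  induction n, hn using Nat.le_induction with
  | base =>
    rw [sum_blockMove_middle hmK w hmK le_rfl, Finset.sum_range_add]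
    simp only [add_comm]
  | succ n hn ih =>
    rw [Finset.sum_range_succ, ih, Finset.sum_range_succ, blockMove_apply,
      if_neg (by omega), if_neg (by omega), if_neg (by omega)]

end blockMove

/-- If `d` is not summable, finitely many tiny terms of `w` can be moved forward so that `d` is
still majorized in this order, and at some late index the surplus is small. -/
theorem exists_perm_surplus_le {d w : ℕ → ℝ} (hd : Antitone d) (hd0 : ∀ n, 0 ≤ d n)
    (hdt : Tendsto d atTop (𝓝 0)) (hsum : ¬ Summable d)
    (hw0 : ∀ n, 0 ≤ w n) (hwt : Tendsto w atTop (𝓝 0)) (hmaj : Majorized d w)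
    {ε : ℝ} (hε : 0 < ε) (N : ℕ) :
    ∃ (π : Equiv.Perm ℕ) (m : ℕ), N ≤ m ∧ (∀ j < N, π j = j) ∧ Majorized d (w ∘ π) ∧
      ∑ j ∈ Finset.range m, w (π j) - ∑ j ∈ Finset.range m, d j ≤ 3 * ε ∧
      ∀ k ≥ m, w (π k) ≤ ε := by
  obtain ⟨N₁, hN₁⟩ := eventually_atTop.1
    ((hwt.eventually (ge_mem_nhds hε)).and (hdt.eventually (ge_mem_nhds hε)))
  obtain ⟨m₀, hm₀, hmin⟩ := exists_almost_min
    (δ := fun m => ∑ j ∈ Finset.range m, w j - ∑ j ∈ Finset.range m, d j)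
    (fun m => sub_nonneg.2 (hmaj m)) hε (max N N₁)
  have hNm : N ≤ m₀ := (le_max_left _ _).trans hm₀
  have hNm₁ : N₁ ≤ m₀ := (le_max_right _ _).trans hm₀
  set δ := fun m => ∑ j ∈ Finset.range m, w j - ∑ j ∈ Finset.range m, d j with hδ
  by_cases hsmall : δ m₀ ≤ ε
  · exact ⟨1, m₀, hNm, fun _ _ => rfl, hmaj, by
      simp only [Equiv.Perm.one_apply]; linarith [show δ m₀ ≤ ε from hsmall],
      fun k hk => (hN₁ k (hNm₁.trans hk)).1⟩
  push Not at hsmall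
  let D : ℕ → ℝ := fun t => ∑ j ∈ Finset.range t, d (m₀ + j)
  have hDt : ∃ t, δ m₀ - ε < D t := by
    have : ¬ Summable fun j => d (m₀ + j) := by
      simpa only [add_comm] using mt (summable_nat_add_iff m₀).1 hsum
    exact ((not_summable_iff_tendsto_nat_atTop_of_nonneg fun j => hd0 _).1 this
      |>.eventually_gt_atTop _).exists
  -- the number of terms to be moved: maximal with `D t ≤ δ m₀ - ε`, so that the surplus at `m₀ + t`
  -- is small, while the tail of the surplus, at least `δ m₀ - ε`, still covers what is used up
  obtain ⟨t, ht, ht'⟩ : ∃ t, D t ≤ δ m₀ - ε ∧ δ m₀ - ε < D (t + 1) := by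
    classical
    have hpos : Nat.find hDt ≠ 0 := fun h => by
      have := Nat.find_spec hDt
      rw [h] at this
      simp only [D, Finset.range_zero, Finset.sum_empty] at this
      linarith
    obtain ⟨t, ht⟩ := Nat.exists_eq_succ_of_ne_zero hpos
    exact ⟨t, not_lt.1 (Nat.find_min hDt (by omega)), by
      have := Nat.find_spec hDt; rwa [ht] at this⟩
  have hε' : 0 < ε / (t + 1) := by positivity
  obtain ⟨K₀, hK₀⟩ := eventually_atTop.1 (hwt.eventually (ge_mem_nhds hε'))
  obtain ⟨K, hK, hmK⟩ : ∃ K, K₀ ≤ K ∧ m₀ ≤ K := ⟨max K₀ m₀, le_max_left _ _, le_max_right _ _⟩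
  have htiny0 : ∀ i, 0 ≤ ∑ l ∈ Finset.range i, w (l + K) := fun i =>
    Finset.sum_nonneg fun l _ => hw0 _
  have htiny : ∑ l ∈ Finset.range t, w (l + K) ≤ ε := by
    calc ∑ l ∈ Finset.range t, w (l + K) ≤ ∑ l ∈ Finset.range t, ε / (t + 1) :=
          Finset.sum_le_sum fun l _ => hK₀ _ (by omega)
      _ = t * (ε / (t + 1)) := by simp
      _ ≤ (t + 1) * (ε / (t + 1)) := by gcongr; linarith
      _ = ε := by field_simp
  have hsplit : ∀ i, ∑ j ∈ Finset.range (m₀ + i), d j = ∑ j ∈ Finset.range m₀, d j + D i :=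
    fun i => Finset.sum_range_add _ _ _
  have hDmono : Monotone D := monotone_nat_of_le_succ fun i => by
    simp only [D, Finset.sum_range_succ]; linarith [hd0 (m₀ + i)]
  refine ⟨blockMove m₀ K t hmK, m₀ + t, by omega, fun j hj => ?_, fun n => ?_, ?_, fun k hk => ?_⟩
  · rw [blockMove_apply, if_pos (by omega)]
  · simp only [Function.comp_apply]
    rcases le_total n m₀ with hn | hn
    · rw [sum_blockMove_of_le hmK w hn]; exact hmaj n
    rcases le_total n (m₀ + t) with hn' | hn'
    · obtain ⟨i, rfl⟩ := Nat.exists_eq_add_of_le hn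
      have hi : i ≤ t := by omega
      rw [sum_blockMove_front hmK w hi, hsplit]
      have h1 := hDmono hi
      have h2 := htiny0 i
      have h3 : δ m₀ = ∑ j ∈ Finset.range m₀, w j - ∑ j ∈ Finset.range m₀, d j := rfl
      linarith
    rcases le_total n (K + t) with hnK | hnK
    -- the surplus at `i + t` is the old one at `i`, up to the tiny terms, minus `t` late terms of
    -- `d`
    · obtain ⟨i, rfl⟩ : ∃ i, n = i + t := ⟨n - t, by omega⟩
      rw [sum_blockMove_middle hmK w (by omega) (by omega), Finset.sum_range_add]
      have h1 : ∑ x ∈ Finset.range t, d (i + x) ≤ D t :=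
        Finset.sum_le_sum fun j _ => hd (by omega)
      have h2 := htiny0 t
      have h3 : δ i = ∑ j ∈ Finset.range i, w j - ∑ j ∈ Finset.range i, d j := rfl
      have h4 := hmin i (by omega)
      linarith
    · rw [sum_blockMove_of_ge hmK w hnK]; exact hmaj n
  · rw [sum_blockMove_front hmK w le_rfl, hsplit]
    have h1 : D (t + 1) = D t + d (m₀ + t) := Finset.sum_range_succ _ _
    have h2 := (hN₁ (m₀ + t) (by omega)).2
    have h3 : δ m₀ = ∑ j ∈ Finset.range m₀, w j - ∑ j ∈ Finset.range m₀, d j := rfl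
    linarith
  · refine (hN₁ _ ?_).1
    rw [blockMove_apply]
    split_ifs <;> omega

end SchurHorn

/-! ### Rotations of orthonormal sequences -/

namespace SchurHorn

variable {H : Type*} [NormedAddCommGroup H] [InnerProductSpace ℂ H]

/-- The real number `⟨A v_j, v_j⟩` (the real part, in general). -/
noncomputable def diagValue (A : H →L[ℂ] H) (v : ℕ → H) (j : ℕ) : ℝ := (⟪v j, A (v j)⟫_ℂ).re

/-- An intermediate stage in the construction of an orthonormal sequence in which `A` has the
diagonal `d`: the first `n` vectors are final, the compression of `A` to the span of the others is
still diagonal, and its diagonal is large enough for the rest of `d` to be achieved. -/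
structure Stage (A : H →L[ℂ] H) (d : ℕ → ℝ) (n : ℕ) (v : ℕ → H) : Prop where
  orthonormal : Orthonormal ℂ v
  total : ∀ x, (∀ i, ⟪v i, x⟫_ℂ = 0) → A x = 0
  value_eq : ∀ j < n, diagValue A v j = d j
  inner_eq_zero : ∀ i ≥ n, ∀ j ≥ n, i ≠ j → ⟪v i, A (v j)⟫_ℂ = 0
  tendsto : Tendsto (diagValue A v) atTop (𝓝 0)
  majorized : Majorized d (diagValue A v)

theorem diagValue_nonneg {A : H →L[ℂ] H} (hA : A.IsPositive) (v : ℕ → H) (j : ℕ) :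
    0 ≤ diagValue A v j := hA.re_inner_nonneg_right _

section rotate

/-- The rotation of a sequence of vectors in the plane of its terms of index `n` and `k`, with the
cosine `c` and the sine `s` (up to the sign of the second vector). -/
noncomputable def rotate (v : ℕ → H) (n k : ℕ) (c s : ℝ) (j : ℕ) : H :=
  if j = n then (c : ℂ) • v n + (s : ℂ) • v k
  else if j = k then (s : ℂ) • v n - (c : ℂ) • v k else v j

variable {v : ℕ → H} {n k : ℕ} {c s : ℝ}

theorem rotate_fst : rotate v n k c s n = (c : ℂ) • v n + (s : ℂ) • v k := if_pos rfl

theorem rotate_snd (hnk : n ≠ k) : rotate v n k c s k = (s : ℂ) • v n - (c : ℂ) • v k := by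
  rw [rotate, if_neg hnk.symm, if_pos rfl]

theorem rotate_of_ne {j : ℕ} (hn : j ≠ n) (hk : j ≠ k) : rotate v n k c s j = v j := by
  rw [rotate, if_neg hn, if_neg hk]

theorem orthonormal_rotate (hv : Orthonormal ℂ v) (hnk : n ≠ k) (hcs : c ^ 2 + s ^ 2 = 1) :
    Orthonormal ℂ (rotate v n k c s) := by
  have h := orthonormal_iff_ite.1 hv
  have hcs' : (c : ℂ) ^ 2 + (s : ℂ) ^ 2 = 1 := by exact_mod_cast hcs
  rw [orthonormal_iff_ite]
  intro i j
  simp only [rotate]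
  split_ifs <;>
  simp only [inner_add_left, inner_add_right, inner_sub_left, inner_sub_right, inner_smul_left,
    inner_smul_right, h, Complex.conj_ofReal] <;> grind

theorem rotate_total (hnk : n ≠ k) (hcs : c ^ 2 + s ^ 2 = 1) {x : H}
    (hx : ∀ i, ⟪rotate v n k c s i, x⟫_ℂ = 0) (i : ℕ) : ⟪v i, x⟫_ℂ = 0 := by
  have hcs' : (c : ℂ) ^ 2 + (s : ℂ) ^ 2 = 1 := by exact_mod_cast hcs
  have h1 := hx n
  have h2 := hx k
  rw [rotate_fst, inner_add_left, inner_smul_left, inner_smul_left] at h1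
  rw [rotate_snd hnk, inner_sub_left, inner_smul_left, inner_smul_left] at h2
  simp only [Complex.conj_ofReal] at h1 h2
  rcases eq_or_ne i n with rfl | hn
  · linear_combination (c : ℂ) * h1 + s * h2 - ⟪v i, x⟫_ℂ * hcs'
  rcases eq_or_ne i k with rfl | hk
  · linear_combination (s : ℂ) * h1 - c * h2 - ⟪v i, x⟫_ℂ * hcs'
  · simpa only [rotate_of_ne hn hk] using hx i

end rotate

/-- One rotation. If the value `a` at `n` exceeds `d n`, let `k > n` be the first index at which the
value is at most `d n`: a rotation of `v n` and `v k` moves the surplus `a - d n` from `n` to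
`k`. -/
theorem Stage.step {A : H →L[ℂ] H} {d : ℕ → ℝ} (hd : Antitone d)
    {n : ℕ} {v : ℕ → H} (hv : Stage A d n v) (hn : 0 < d n ∨ diagValue A v n ≤ d n) :
    ∃ v', Stage A d (n + 1) v' ∧ (∀ j < n, v' j = v j) ∧
      (∀ j > n, diagValue A v j ≤ diagValue A v' j) ∧
      Majorized (diagValue A v') (diagValue A v) ∧
      ∀ᶠ m in atTop, ∑ j ∈ Finset.range m, diagValue A v' j
        = ∑ j ∈ Finset.range m, diagValue A v j := by
  have hge : d n ≤ diagValue A v n := by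
    have h1 := hv.majorized (n + 1)
    rw [Finset.sum_range_succ, Finset.sum_range_succ,
      Finset.sum_congr rfl fun j hj => hv.value_eq j (Finset.mem_range.1 hj)] at h1
    linarith
  by_cases hle : diagValue A v n ≤ d n
  · refine ⟨v, ⟨hv.orthonormal, hv.total, fun j hj => ?_, fun i hi j hj =>
      hv.inner_eq_zero i (by omega) j (by omega), hv.tendsto, hv.majorized⟩,
      fun _ _ => rfl, fun _ _ => le_rfl, fun _ => le_rfl, Eventually.of_forall fun _ => rfl⟩
    rcases Nat.lt_succ_iff_lt_or_eq.1 hj with h | rfl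
    · exact hv.value_eq j h
    · exact le_antisymm hle hge
  have hdn : 0 < d n := hn.resolve_right hle
  push Not at hle
  have hex : ∃ k, n < k ∧ diagValue A v k ≤ d n :=
    ((eventually_gt_atTop n).and (hv.tendsto.eventually (ge_mem_nhds hdn))).exists
  classical
  obtain ⟨k, ⟨hnk, hk⟩, hkmin⟩ : ∃ k, (n < k ∧ diagValue A v k ≤ d n) ∧
      ∀ j, n < j → j < k → d n < diagValue A v j :=
    ⟨Nat.find hex, Nat.find_spec hex, fun j hj hjk => by
      by_contra hcon
      exact Nat.find_min hex hjk ⟨hj, not_lt.1 hcon⟩⟩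
  have hab : 0 < diagValue A v n - diagValue A v k := by linarith
  -- the squares of the cosine and the sine of the angle of rotation
  set p := (d n - diagValue A v k) / (diagValue A v n - diagValue A v k) with hp
  have hp0 : 0 ≤ p := div_nonneg (by linarith) hab.le
  have hp1 : p ≤ 1 := (div_le_one hab).2 (by linarith)
  have hpe : p * diagValue A v n + (1 - p) * diagValue A v k = d n := by
    rw [hp]; field_simp; ring
  have hc := Real.sq_sqrt hp0
  have hs := Real.sq_sqrt (sub_nonneg.2 hp1)
  set c := √p
  set s := √(1 - p)
  have hcs : c ^ 2 + s ^ 2 = 1 := by rw [hc, hs]; ring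
  have h12 : ⟪v n, A (v k)⟫_ℂ = 0 := hv.inner_eq_zero n le_rfl k hnk.le hnk.ne
  have h21 : ⟪v k, A (v n)⟫_ℂ = 0 := hv.inner_eq_zero k hnk.le n le_rfl hnk.ne'
  have hvn : diagValue A (rotate v n k c s) n = d n := by
    rw [diagValue, rotate_fst]
    simp only [map_add, map_smul, inner_add_left, inner_add_right, inner_smul_left,
      inner_smul_right, h12, h21, Complex.conj_ofReal, Complex.add_re, Complex.re_ofReal_mul,
      mul_zero, Complex.zero_re]
    rw [← hpe, ← hs, ← hc]
    simp only [diagValue]; ring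
  have hvk : diagValue A (rotate v n k c s) k
      = diagValue A v k + (diagValue A v n - d n) := by
    rw [diagValue, rotate_snd hnk.ne]
    simp only [map_sub, map_smul, inner_sub_left, inner_sub_right, inner_smul_left,
      inner_smul_right, h12, h21, Complex.conj_ofReal, Complex.sub_re, Complex.re_ofReal_mul,
      mul_zero, Complex.zero_re]
    rw [← hpe]
    have e : s ^ 2 * diagValue A v n + c ^ 2 * diagValue A v k =
      (1 - p) * diagValue A v n + p * diagValue A v k := by rw [hc, hs]
    simp only [diagValue] at e ⊢
    linarith
  have hvj : ∀ j, j ≠ n → j ≠ k → diagValue A (rotate v n k c s) j = diagValue A v j :=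
    fun j hjn hjk => by rw [diagValue, rotate_of_ne hjn hjk, diagValue]
  -- the partial sums change only between `n` and `k`, by the surplus that is moved
  have hsum1 : ∀ m ≤ n, ∑ j ∈ Finset.range m, diagValue A (rotate v n k c s) j
      = ∑ j ∈ Finset.range m, diagValue A v j := fun m hm =>
    Finset.sum_congr rfl fun j hj => by
      have := Finset.mem_range.1 hj
      exact hvj j (by omega) (by omega)
  have hsum2 : ∀ m, n < m → m ≤ k → ∑ j ∈ Finset.range m, diagValue A (rotate v n k c s) j
      = ∑ j ∈ Finset.range m, diagValue A v j - (diagValue A v n - d n) := by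
    intro m hm
    induction m, hm using Nat.le_induction with
    | base =>
      intro _
      rw [Finset.sum_range_succ, Finset.sum_range_succ, hsum1 n le_rfl, hvn]; ring
    | succ m hm ih =>
      intro hmk
      rw [Finset.sum_range_succ, Finset.sum_range_succ, ih (by omega),
        hvj m (by omega) (by omega)]; ring
  have hsum3 : ∀ m, k < m → ∑ j ∈ Finset.range m, diagValue A (rotate v n k c s) j
      = ∑ j ∈ Finset.range m, diagValue A v j := by
    intro m hm
    induction m, hm using Nat.le_induction with
    | base =>
      rw [Finset.sum_range_succ, Finset.sum_range_succ, hsum2 k hnk le_rfl, hvk]; ring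
    | succ m hm ih =>
      rw [Finset.sum_range_succ, Finset.sum_range_succ, ih, hvj m (by omega) (by omega)]
  refine ⟨rotate v n k c s, ⟨orthonormal_rotate hv.orthonormal hnk.ne hcs, fun x hx =>
    hv.total x (rotate_total hnk.ne hcs hx), fun j hj => ?_, fun i hi j hj hij => ?_, ?_,
    fun m => ?_⟩, fun j hj => rotate_of_ne (by omega) (by omega), fun j hj => ?_, fun m => ?_,
    (eventually_gt_atTop k).mono hsum3⟩
  · rcases Nat.lt_succ_iff_lt_or_eq.1 hj with h | rfl
    · rw [hvj j (by omega) (by omega), hv.value_eq j h]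
    · exact hvn
  · have h0 : ∀ i j, n ≤ i → n ≤ j → i ≠ j → ⟪v i, A (v j)⟫_ℂ = 0 :=
      fun i j hi hj => hv.inner_eq_zero i hi j hj
    rcases eq_or_ne i k with rfl | hik
    · rw [rotate_snd hnk.ne, rotate_of_ne (by omega) (by omega), inner_sub_left, inner_smul_left,
        inner_smul_left, h0 n j le_rfl (by omega) (by omega), h0 i j (by omega) (by omega) hij]
      simp
    rcases eq_or_ne j k with rfl | hjk
    · rw [rotate_snd hnk.ne, rotate_of_ne (by omega) (by omega), map_sub, map_smul, map_smul,
        inner_sub_right, inner_smul_right,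
        inner_smul_right, h0 i n (by omega) le_rfl (by omega), h0 i j (by omega) (by omega) hij]
      simp
    · rw [rotate_of_ne (by omega) hik, rotate_of_ne (by omega) hjk]
      exact h0 i j (by omega) (by omega) hij
  · refine hv.tendsto.congr' ((eventually_gt_atTop k).mono fun j hj => ?_)
    exact (hvj j (by omega) (by omega)).symm
  -- up to `k` the new values dominate `d` termwise, since `k` is the first index with `w_k ≤ d_n`
  · rcases le_or_gt m k with hmk | hmk
    · refine Finset.sum_le_sum fun j hj => ?_
      have hjm := Finset.mem_range.1 hj
      rcases lt_trichotomy j n with h | rfl | h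
      · rw [hvj j (by omega) (by omega), hv.value_eq j h]
      · exact hvn.ge
      · rw [hvj j (by omega) (by omega)]
        exact (hd h.le).trans (hkmin j h (by omega)).le
    · rw [hsum3 m hmk]; exact hv.majorized m
  · rcases eq_or_ne j k with rfl | hjk
    · rw [hvk]; linarith
    · exact (hvj j (by omega) hjk).ge
  · rcases le_or_gt m n with hmn | hmn
    · exact (hsum1 m hmn).le
    rcases le_or_gt m k with hmk | hmk
    · rw [hsum2 m hmn hmk]; linarith
    · exact (hsum3 m hmk).le

/-- Either `d` has an infinite sum (for `d ≥ 0`), or the lower limit of the surplus of `w` over `d`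
is not positive: the condition under which a majorized `d` is the diagonal of an operator with the
eigenvalues `w`. -/
def Exhausts (d w : ℕ → ℝ) : Prop :=
  ¬ Summable d ∨ ∀ ε > 0, ∃ᶠ m in atTop,
    ∑ j ∈ Finset.range m, w j - ∑ j ∈ Finset.range m, d j < ε

theorem Exhausts.congr {d w w' : ℕ → ℝ} (h : Exhausts d w)
    (hw : ∀ᶠ m in atTop, ∑ j ∈ Finset.range m, w' j = ∑ j ∈ Finset.range m, w j) :
    Exhausts d w' :=
  h.imp_right fun h ε hε => ((h ε hε).and_eventually hw).mono fun m hm => by rw [hm.2]; exact hm.1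

/-- If `d n = 0`, then `d` is summable and no later term of `d` could absorb a surplus at `n`, so
there is none. -/
theorem Stage.pos_or_value_le {A : H →L[ℂ] H} (hA : A.IsPositive) {d : ℕ → ℝ} (hd : Antitone d)
    (hd0 : ∀ n, 0 ≤ d n) {n : ℕ} {v : ℕ → H} (hv : Stage A d n v)
    (hex : Exhausts d (diagValue A v)) : 0 < d n ∨ diagValue A v n ≤ d n := by
  rcases (hd0 n).lt_or_eq with h | h
  · exact Or.inl h
  right
  have hzero : ∀ j ≥ n, d j = 0 := fun j hj => le_antisymm ((hd hj).trans h.symm.le) (hd0 j)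
  rcases hex with hex | hex
  · refine absurd (summable_of_hasFiniteSupport ((Set.finite_lt_nat n).subset fun j hj => ?_)) hex
    by_contra hcon
    exact hj (hzero j (not_lt.1 hcon))
  · refine le_of_forall_pos_le_add fun ε hε => ?_
    obtain ⟨m, hm, hmn⟩ := ((hex ε hε).and_eventually (eventually_gt_atTop n)).exists
    obtain ⟨i, rfl⟩ := Nat.exists_eq_add_of_le (Nat.succ_le_of_lt hmn)
    rw [Finset.sum_range_add, Finset.sum_range_add (fun j => d j), Finset.sum_range_succ,
      Finset.sum_range_succ, Finset.sum_congr rfl fun j hj => hv.value_eq j (Finset.mem_range.1 hj)]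
      at hm
    have h1 : ∑ x ∈ Finset.range i, d (n.succ + x) = 0 :=
      Finset.sum_eq_zero fun x _ => hzero _ (by omega)
    have h2 : 0 ≤ ∑ x ∈ Finset.range i, diagValue A v (n.succ + x) :=
      Finset.sum_nonneg fun x _ => diagValue_nonneg hA v _
    simp only [Nat.succ_eq_add_one] at h1 h2
    linarith

/-- Iterated rotations. The surplus that is moved beyond the index `m` is at most the partial sum of
all surpluses before `m`. -/
theorem Stage.advance {A : H →L[ℂ] H} (hA : A.IsPositive) {d : ℕ → ℝ} (hd : Antitone d)
    (hd0 : ∀ n, 0 ≤ d n) {n : ℕ} {v : ℕ → H} (hv : Stage A d n v)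
    (hex : Exhausts d (diagValue A v)) {m : ℕ} (hm : n ≤ m) :
    ∃ v', Stage A d m v' ∧ Exhausts d (diagValue A v') ∧ (∀ j < n, v' j = v j) ∧
      ∀ k ≥ m, diagValue A v' k ≤ diagValue A v k +
        (∑ j ∈ Finset.range m, diagValue A v j - ∑ j ∈ Finset.range m, d j) := by
  obtain ⟨v', h1, h2, h3, h4, h5⟩ : ∃ v', Stage A d m v' ∧ Exhausts d (diagValue A v') ∧
      (∀ j < n, v' j = v j) ∧ (∀ j ≥ m, diagValue A v j ≤ diagValue A v' j) ∧
      Majorized (diagValue A v') (diagValue A v) := by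
    induction m, hm using Nat.le_induction with
    | base => exact ⟨v, hv, hex, fun _ _ => rfl, fun _ _ => le_rfl, fun _ => le_rfl⟩
    | succ m hm ih =>
      obtain ⟨v', h1, h2, h3, h4, h5⟩ := ih
      obtain ⟨u, hu1, hu2, hu3, hu4, hu5⟩ := h1.step hd (h1.pos_or_value_le hA hd hd0 h2)
      exact ⟨u, hu1, h2.congr hu5, fun j hj => (hu2 j (by omega)).trans (h3 j hj),
        fun j hj => (h4 j (by omega)).trans (hu3 j (by omega)),
        fun i => (hu4 i).trans (h5 i)⟩
  -- compare the partial sums up to `k + 1`: before `m` the new values are `d`, from `m` on they are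
  -- not smaller than the old ones
  refine ⟨v', h1, h2, h3, fun k hk => ?_⟩
  have hk1 := h5 (k + 1)
  obtain ⟨i, rfl⟩ := Nat.exists_eq_add_of_le hk
  rw [Finset.sum_range_succ, Finset.sum_range_succ, Finset.sum_range_add,
    Finset.sum_range_add (fun j => diagValue A v j),
    Finset.sum_congr rfl fun j hj => h1.value_eq j (Finset.mem_range.1 hj)] at hk1
  have : ∑ x ∈ Finset.range i, diagValue A v (m + x) ≤
      ∑ x ∈ Finset.range i, diagValue A v' (m + x) :=
    Finset.sum_le_sum fun x _ => h4 _ (by omega)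
  linarith

theorem Stage.perm {A : H →L[ℂ] H} {d : ℕ → ℝ} {n : ℕ} {v : ℕ → H} (hv : Stage A d n v)
    {π : Equiv.Perm ℕ} (hπ : ∀ j < n, π j = j) (hmaj : Majorized d (diagValue A v ∘ π)) :
    Stage A d n (v ∘ π) := by
  have hge : ∀ i ≥ n, n ≤ π i := fun i hi => by
    by_contra! hcon
    have := π.injective (hπ _ hcon)
    omega
  have htend := π.injective.tendsto_cofinite
  rw [Nat.cofinite_eq_atTop] at htend
  refine ⟨hv.orthonormal.comp π π.injective, fun x hx => hv.total x fun i => ?_, fun j hj => ?_,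
    fun i hi j hj hij => hv.inner_eq_zero _ (hge i hi) _ (hge j hj) (π.injective.ne hij),
    hv.tendsto.comp htend, hmaj⟩
  · simpa using hx (π.symm i)
  · rw [diagValue, Function.comp_apply, hπ j hj]
    exact hv.value_eq j hj

/-- From every stage a later one can be reached at which the remaining values are small. -/
theorem Stage.exists_values_le {A : H →L[ℂ] H} (hA : A.IsPositive) {d : ℕ → ℝ} (hd : Antitone d)
    (hd0 : ∀ n, 0 ≤ d n) (hdt : Tendsto d atTop (𝓝 0)) {n : ℕ} {v : ℕ → H} (hv : Stage A d n v)
    (hex : Exhausts d (diagValue A v)) {ε : ℝ} (hε : 0 < ε) :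
    ∃ m v', n < m ∧ Stage A d m v' ∧ Exhausts d (diagValue A v') ∧ (∀ j < n, v' j = v j) ∧
      ∀ k ≥ m, diagValue A v' k ≤ ε := by
  by_cases hsum : Summable d
  · have hfreq := hex.resolve_left (not_not.2 hsum) (ε / 2) (half_pos hε)
    obtain ⟨N, hN⟩ := eventually_atTop.1 (hv.tendsto.eventually (ge_mem_nhds (half_pos hε)))
    obtain ⟨m, hm, hmn, hmN⟩ := (hfreq.and_eventually
      ((eventually_gt_atTop n).and (eventually_ge_atTop N))).exists
    obtain ⟨v', h1, h2, h3, h4⟩ := hv.advance hA hd hd0 hex hmn.le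
    exact ⟨m, v', hmn, h1, h2, h3, fun k hk => by
      have := h4 k hk
      have := hN k (hmN.trans hk)
      linarith⟩
  · obtain ⟨π, m, hm, hπ, hmaj, hsmall, hval⟩ := exists_perm_surplus_le hd hd0 hdt hsum
      (diagValue_nonneg hA v) hv.tendsto hv.majorized (show 0 < ε / 4 by linarith) (n + 1)
    have hπv := hv.perm (fun j hj => hπ j (by omega)) hmaj
    obtain ⟨v', h1, h2, h3, h4⟩ := hπv.advance hA hd hd0 (Or.inl hsum) (show n ≤ m by omega)
    refine ⟨m, v', by omega, h1, h2, fun j hj => ?_, fun k hk => ?_⟩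
    · rw [h3 j hj, Function.comp_apply, hπ j (by omega)]
    · have e1 := h4 k hk
      have e2 := hval k hk
      have e : ∀ j, diagValue A (v ∘ π) j = diagValue A v (π j) := fun j => rfl
      simp only [e] at e1
      linarith

end SchurHorn

/-! ### The limit of the rotations -/

namespace SchurHorn

variable {H : Type*} [NormedAddCommGroup H] [InnerProductSpace ℂ H] [CompleteSpace H]

/-- The projection of `x` to the closed span of an orthonormal sequence, as a series. -/
theorem exists_hasSum_orthonormal {v : ℕ → H} (hv : Orthonormal ℂ v) (x : H) :
    ∃ y, HasSum (fun i => ⟪v i, x⟫_ℂ • v i) y ∧ ∀ i, ⟪v i, x - y⟫_ℂ = 0 := by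
  have hs : Summable fun i => ⟪v i, x⟫_ℂ • v i := by
    have := (hv.orthogonalFamily.summable_iff_norm_sq_summable fun i => ⟪v i, x⟫_ℂ).2
      (hv.inner_products_summable x)
    simpa using this
  refine ⟨_, hs.hasSum, fun i => ?_⟩
  have h1 := hs.hasSum.mapL (innerSL ℂ (v i))
  have h2 : HasSum (fun j => innerSL ℂ (v i) (⟪v j, x⟫_ℂ • v j)) ⟪v i, x⟫_ℂ := by
    convert hasSum_single (α := ℂ) i fun j hj => ?_ using 1
    · simp [hv.1 i]
    · simp [hv.2 hj.symm]
  rw [inner_sub_right, sub_eq_zero]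
  exact h2.unique h1

theorem apply_eq_zero_of_re_inner_eq_zero {A : H →L[ℂ] H} (hA : A.IsPositive) {x : H}
    (hx : (⟪x, A x⟫_ℂ).re = 0) : A x = 0 := by
  have hA0 : 0 ≤ A := (ContinuousLinearMap.nonneg_iff_isPositive A).2 hA
  have hSS : CFC.sqrt A * CFC.sqrt A = A := CFC.sqrt_mul_sqrt_self A hA0
  have hS : (CFC.sqrt A).IsPositive :=
    (ContinuousLinearMap.nonneg_iff_isPositive _).1 (CFC.sqrt_nonneg A)
  have hap : ∀ y, A y = CFC.sqrt A (CFC.sqrt A y) := fun y => by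
    conv_lhs => rw [← hSS]
    rfl
  rw [hap, ← hS.inner_left_eq_inner_right, inner_self_eq_norm_sq_to_K] at hx
  have : ‖CFC.sqrt A x‖ ^ 2 = 0 := by exact_mod_cast hx
  rw [hap, norm_eq_zero.1 (pow_eq_zero_iff two_ne_zero |>.1 this), map_zero]

/-- The compression of `A` to the vectors that are not yet final is at most `ε`. -/
theorem Stage.re_inner_le {A : H →L[ℂ] H} (hA : A.IsPositive) {d : ℕ → ℝ} {n : ℕ} {v : ℕ → H}
    (hv : Stage A d n v) {ε : ℝ} (hε : ∀ k ≥ n, diagValue A v k ≤ ε) (hε0 : 0 ≤ ε) {x : H}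
    (hx : ∀ j < n, ⟪v j, x⟫_ℂ = 0) : (⟪x, A x⟫_ℂ).re ≤ ε * ‖x‖ ^ 2 := by
  obtain ⟨y, hy, hxy⟩ := exists_hasSum_orthonormal hv.orthonormal x
  have hAxy : A x = A y := by
    have := hv.total _ hxy
    rwa [map_sub, sub_eq_zero] at this
  have hin : ⟪x, A x⟫_ℂ = ⟪y, A y⟫_ℂ := by
    rw [hAxy, ← hA.inner_left_eq_inner_right, hAxy, hA.inner_left_eq_inner_right]
  rw [hin]
  have hlim := hy.tendsto_sum_nat
  have hlim' : Tendsto (fun M => (⟪∑ i ∈ Finset.range M, ⟪v i, x⟫_ℂ • v i,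
      A (∑ i ∈ Finset.range M, ⟪v i, x⟫_ℂ • v i)⟫_ℂ).re) atTop (𝓝 (⟪y, A y⟫_ℂ).re) :=
    (Complex.continuous_re.tendsto _).comp (hlim.inner ((A.continuous.tendsto _).comp hlim))
  refine le_of_tendsto' hlim' fun M => ?_
  have hkey : ∀ i j, ⟪⟪v i, x⟫_ℂ • v i, A (⟪v j, x⟫_ℂ • v j)⟫_ℂ =
      if i = j then ((‖⟪v i, x⟫_ℂ‖ ^ 2 : ℝ) : ℂ) * ⟪v i, A (v i)⟫_ℂ else 0 := by
    intro i j
    rw [map_smul, inner_smul_left, inner_smul_right]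
    split_ifs with hij
    · subst hij
      rw [← mul_assoc, Complex.conj_mul']
      push_cast; rfl
    · rcases lt_or_ge i n with hi | hi
      · simp [hx i hi]
      rcases lt_or_ge j n with hj | hj
      · simp [hx j hj]
      · simp [hv.inner_eq_zero i hi j hj hij]
  rw [map_sum, sum_inner, Complex.re_sum]
  calc ∑ i ∈ Finset.range M, (⟪⟪v i, x⟫_ℂ • v i,
        ∑ j ∈ Finset.range M, A (⟪v j, x⟫_ℂ • v j)⟫_ℂ).re
      = ∑ i ∈ Finset.range M, ‖⟪v i, x⟫_ℂ‖ ^ 2 * diagValue A v i := by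
        refine Finset.sum_congr rfl fun i hi => ?_
        rw [inner_sum, Finset.sum_congr rfl fun j _ => hkey i j, Finset.sum_ite_eq, if_pos hi,
          Complex.re_ofReal_mul, diagValue]
    _ ≤ ∑ i ∈ Finset.range M, ‖⟪v i, x⟫_ℂ‖ ^ 2 * ε := by
        refine Finset.sum_le_sum fun i _ => ?_
        rcases lt_or_ge i n with hi | hi
        · simp [hx i hi]
        · exact mul_le_mul_of_nonneg_left (hε i hi) (sq_nonneg _)
    _ ≤ ε * ‖x‖ ^ 2 := by
        rw [← Finset.sum_mul, mul_comm]
        exact mul_le_mul_of_nonneg_left (hv.orthonormal.sum_inner_products_le x) hε0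

/-- The limit of the stages: an orthonormal sequence, complete modulo the kernel of `A`, in which
`A` has the diagonal `d`. -/
theorem Stage.exists_orthonormal {A : H →L[ℂ] H} (hA : A.IsPositive) {d : ℕ → ℝ}
    (hd : Antitone d) (hd0 : ∀ n, 0 ≤ d n) (hdt : Tendsto d atTop (𝓝 0)) {v : ℕ → H}
    (hv : Stage A d 0 v) (hex : Exhausts d (diagValue A v)) :
    ∃ g : ℕ → H, Orthonormal ℂ g ∧ (∀ j, diagValue A g j = d j) ∧
      ∀ x, (∀ j, ⟪g j, x⟫_ℂ = 0) → A x = 0 := by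
  let S := {p : ℕ × (ℕ → H) // Stage A d p.1 p.2 ∧ Exhausts d (diagValue A p.2)}
  have hnext : ∀ (i : ℕ) (p : S), ∃ q : S, p.1.1 < q.1.1 ∧ (∀ j < p.1.1, q.1.2 j = p.1.2 j) ∧
      ∀ k ≥ q.1.1, diagValue A q.1.2 k ≤ 1 / ((i : ℝ) + 1) := fun i p => by
    obtain ⟨m, v', h1, h2, h3, h4, h5⟩ := p.2.1.exists_values_le hA hd hd0 hdt p.2.2
      (show 0 < 1 / ((i : ℝ) + 1) by positivity)
    exact ⟨⟨(m, v'), h2, h3⟩, h1, h4, h5⟩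
  choose next hlt hagree hsmall using hnext
  let seq : ℕ → S := fun i => Nat.rec ⟨(0, v), hv, hex⟩ next i
  have hseq : ∀ i, seq (i + 1) = next i (seq i) := fun i => rfl
  have hmono : StrictMono fun i => (seq i).1.1 := strictMono_nat_of_lt_succ fun i => by
    rw [hseq]; exact hlt i (seq i)
  have hid : ∀ i, i ≤ (seq i).1.1 := hmono.id_le
  have hag : ∀ i i', i ≤ i' → ∀ j < (seq i).1.1, (seq i').1.2 j = (seq i).1.2 j := by
    intro i i' hi
    induction i', hi using Nat.le_induction with
    | base => intro _ _; rfl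
    | succ i' hi ih =>
      intro j hj
      rw [hseq, hagree i' (seq i') j (hj.trans_le (hmono.monotone hi)), ih j hj]
  let g : ℕ → H := fun j => (seq (j + 1)).1.2 j
  have hg : ∀ i, ∀ j < (seq i).1.1, g j = (seq i).1.2 j := by
    intro i j hj
    rcases le_total i (j + 1) with h | h
    · exact hag _ _ h j hj
    · exact (hag _ _ h j ((Nat.lt_succ_self j).trans_le (hid (j + 1)))).symm
  refine ⟨g, ?_, fun j => ?_, fun x hx => ?_⟩
  · rw [orthonormal_iff_ite]
    intro i j
    have hi : i < (seq (max i j + 1)).1.1 := by have := hid (max i j + 1); omega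
    have hj : j < (seq (max i j + 1)).1.1 := by have := hid (max i j + 1); omega
    rw [hg (max i j + 1) i hi, hg (max i j + 1) j hj]
    exact orthonormal_iff_ite.1 (seq (max i j + 1)).2.1.orthonormal i j
  · exact (seq (j + 1)).2.1.value_eq j (hid (j + 1))
  · refine apply_eq_zero_of_re_inner_eq_zero hA (le_antisymm ?_ (hA.re_inner_nonneg_right x))
    have hlim : Tendsto (fun i : ℕ => 1 / ((i : ℝ) + 1) * ‖x‖ ^ 2) atTop (𝓝 0) := by
      simpa using tendsto_one_div_add_atTop_nhds_zero_nat.mul_const (‖x‖ ^ 2)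
    refine ge_of_tendsto' hlim fun i => ?_
    exact (seq (i + 1)).2.1.re_inner_le hA (hsmall i (seq i)) (by positivity)
      fun j hj => hg (i + 1) j hj ▸ hx j

end SchurHorn

namespace SchurHorn

/-! ### Diagonal operators -/

section diag

variable {H : Type*} [NormedAddCommGroup H] [InnerProductSpace ℂ H]

theorem inner_diag (e : HilbertBasis ℕ ℂ H) (ρ : lp (fun _ : ℕ => ℂ) ∞) (n : ℕ) (x : H) :
    ⟪e n, diag e ρ x⟫_ℂ = ρ n * ⟪e n, x⟫_ℂ := by
  rw [← e.repr_apply_apply, ← e.repr_apply_apply]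
  simp [diag]

theorem mainDiagonal_apply (e : HilbertBasis ℕ ℂ H) (T : H →L[ℂ] H) (n : ℕ) :
    mainDiagonal e T n = ⟪e n, T (e n)⟫_ℂ := rfl

theorem norm_diag_le (e : HilbertBasis ℕ ℂ H) (ρ : lp (fun _ : ℕ => ℂ) ∞) :
    ‖diag e ρ‖ ≤ ‖ρ‖ := by
  refine ContinuousLinearMap.opNorm_le_bound _ (norm_nonneg _) fun x => ?_
  have := (lp.mapCLM 2 (fun i => ρ i • ContinuousLinearMap.id ℂ ℂ) (norm_nonneg ρ)
      (fun i => by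
        simpa [norm_smul] using lp.norm_apply_le_norm ENNReal.top_ne_zero ρ i)).le_of_opNorm_le
      (lp.norm_mapCLM_le 2 _ (norm_nonneg ρ) _) (e.repr x)
  simpa [diag] using this

theorem isPositive_diag (e : HilbertBasis ℕ ℂ H) (ρ : lp (fun _ : ℕ => ℂ) ∞) {d : ℕ → ℝ}
    (hd : ∀ n, 0 ≤ d n) (hρ : ∀ n, ρ n = d n) : (diag e ρ).IsPositive := by
  have hexp : ∀ x y, HasSum (fun n => (d n : ℂ) * (⟪x, e n⟫_ℂ * ⟪e n, y⟫_ℂ)) ⟪x, diag e ρ y⟫_ℂ := by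
    intro x y
    refine (e.hasSum_inner_mul_inner x (diag e ρ y)).congr_fun fun n => ?_
    rw [inner_diag, hρ]; ring
  refine ⟨fun x y => ?_, fun x => ?_⟩
  · refine HasSum.unique ((e.hasSum_inner_mul_inner (diag e ρ x) y).congr_fun fun n => ?_)
      (hexp x y)
    rw [← inner_conj_symm (diag e ρ x), inner_diag, hρ, map_mul, Complex.conj_ofReal,
      inner_conj_symm]; ring
  · rw [ContinuousLinearMap.reApplyInnerSelf_apply, inner_re_symm]
    refine (Complex.hasSum_re (hexp x x)).nonneg fun n => ?_
    rw [← inner_conj_symm x, Complex.conj_mul', ← Complex.ofReal_pow, ← Complex.ofReal_mul,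
      Complex.ofReal_re]
    exact mul_nonneg (hd n) (sq_nonneg _)

end diag

variable {H : Type*} [NormedAddCommGroup H] [InnerProductSpace ℂ H] [CompleteSpace H]

/-! ### Spectral theory of positive compact operators -/

theorem tendsto_apply_orthonormal {T : H →L[ℂ] H} (hT : IsCompactOperator T) {v : ℕ → H}
    (hv : Orthonormal ℂ v) : Tendsto (fun n => T (v n)) atTop (𝓝 0) := by
  obtain ⟨K, hK, hTK⟩ := IsCompactOperator.image_closedBall_subset_compact
    (f := (T : H →ₗ[ℂ] H)) hT 1
  have hmem : ∀ n, T (v n) ∈ K := fun n => hTK ⟨v n, by simp [hv.1 n], rfl⟩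
  have hweak : ∀ z, Tendsto (fun n => ⟪z, T (v n)⟫_ℂ) atTop (𝓝 0) := by
    intro z
    have h1 := (hv.inner_products_summable (ContinuousLinearMap.adjoint T z)).tendsto_atTop_zero
    rw [tendsto_zero_iff_norm_tendsto_zero]
    have h2 : Tendsto (fun n => √(‖⟪v n, ContinuousLinearMap.adjoint T z⟫_ℂ‖ ^ 2)) atTop (𝓝 0) := by
      simpa using h1.sqrt
    refine h2.congr fun n => ?_
    rw [Real.sqrt_sq (norm_nonneg _), ContinuousLinearMap.adjoint_inner_right, norm_inner_symm]
  refine tendsto_of_subseq_tendsto fun ns hns => ?_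
  obtain ⟨y, -, φ, hφ, hy⟩ := hK.tendsto_subseq fun n => hmem (ns n)
  refine ⟨φ, ?_⟩
  have hy0 : y = 0 := ext_inner_left ℂ fun z => by
    rw [inner_zero_right]
    exact tendsto_nhds_unique (tendsto_const_nhds.inner hy)
      ((hweak z).comp (hns.comp hφ.tendsto_atTop))
  rwa [hy0] at hy

/-- The spectral theorem for positive compact operators on a separable infinite-dimensional Hilbert
space. -/
theorem exists_eigenbasis (e : HilbertBasis ℕ ℂ H) {T : H →L[ℂ] H} (hT : IsCompactOperator T)
    (hpos : T.IsPositive) :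
    ∃ (b : HilbertBasis ℕ ℂ H) (μ : ℕ → ℝ), (∀ i, 0 ≤ μ i) ∧ Tendsto μ atTop (𝓝 0) ∧
      ∀ i, T (b i) = (μ i : ℂ) • b i := by
  have hclosed : ∀ μ : ℂ, CompleteSpace (Module.End.eigenspace (T : H →ₗ[ℂ] H) μ) := fun μ => by
    have hset : (Module.End.eigenspace (T : H →ₗ[ℂ] H) μ : Set H) = {x | T x = μ • x} := by
      ext x; exact Module.End.mem_eigenspace_iff
    have : IsClosed (Module.End.eigenspace (T : H →ₗ[ℂ] H) μ : Set H) := by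
      rw [hset]
      exact isClosed_eq T.continuous (continuous_const_smul μ)
    exact this.completeSpace_coe
  -- orthonormal bases `B μ` of all eigenspaces form together one of `H`
  choose w B _ using fun μ : ℂ =>
    exists_hilbertBasis ℂ (Module.End.eigenspace (T : H →ₗ[ℂ] H) μ)
  let v : (Σ μ : ℂ, w μ) → H := fun a => (B a.1 a.2 : H)
  have hvo : Orthonormal ℂ v :=
    hpos.isSymmetric.orthogonalFamily_eigenspaces.orthonormal_sigma_orthonormal
      fun μ => (B μ).orthonormal
  have hvt : (Submodule.span ℂ (Set.range v))ᗮ = ⊥ := by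
    rw [eq_bot_iff, ← T.orthogonalComplement_iSup_eigenspaces_eq_bot hT hpos.isSymmetric]
    intro x hx
    rw [Submodule.mem_orthogonal] at hx
    rw [← Submodule.iInf_orthogonal, Submodule.mem_iInf]
    intro μ
    rw [Submodule.mem_orthogonal']
    intro y hy
    have hs := (((B μ).hasSum_repr ⟨y, hy⟩).mapL
      (Module.End.eigenspace (T : H →ₗ[ℂ] H) μ).subtypeL).mapL (innerSL ℂ x)
    refine hs.unique ?_
    convert hasSum_zero with i
    have := hx _ (Submodule.subset_span ⟨⟨μ, i⟩, rfl⟩)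
    have : ⟪x, (B μ i : H)⟫_ℂ = 0 := inner_eq_zero_symm.1 this
    simp [this]
  let C := HilbertBasis.mkOfOrthogonalEqBot hvo hvt
  -- every vector of the basis meets some `e n`, and for each `n` only countably many do
  have hcount : Countable (Σ μ : ℂ, w μ) := by
    have : (⋃ n, Function.support fun a => ‖⟪v a, e n⟫_ℂ‖ ^ 2) = Set.univ := by
      refine Set.eq_univ_of_forall fun a => ?_
      by_contra hcon
      simp only [Set.mem_iUnion, Function.mem_support, not_exists, not_not] at hcon
      have hva : v a = 0 := by
        refine (e.hasSum_repr (v a)).unique ?_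
        convert hasSum_zero with n
        have := hcon n
        rw [pow_eq_zero_iff two_ne_zero, norm_eq_zero, inner_eq_zero_symm] at this
        rw [e.repr_apply_apply, this, zero_smul]
      have := hvo.1 a
      rw [hva, norm_zero] at this
      exact zero_ne_one this
    rw [← Set.countable_univ_iff, ← this]
    exact Set.countable_iUnion fun n => (hvo.inner_products_summable (e n)).countable_support
  have hinf : Infinite (Σ μ : ℂ, w μ) := by
    by_contra hfin
    rw [not_infinite_iff_finite] at hfin
    have := Fintype.ofFinite (Σ μ : ℂ, w μ)
    have hfd : FiniteDimensional ℂ H := C.toOrthonormalBasis.toBasis.finiteDimensional_of_finite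
    have := e.orthonormal.linearIndependent.finite
    exact not_finite ℕ
  obtain ⟨hden⟩ := nonempty_denumerable (Σ μ : ℂ, w μ)
  let φ : ℕ ≃ Σ μ : ℂ, w μ := (Denumerable.eqv _).symm
  have ho : Orthonormal ℂ (v ∘ φ) := hvo.comp φ φ.injective
  have hTv : ∀ a, T (v a) = a.1 • v a := fun a => Module.End.mem_eigenspace_iff.1 (B a.1 a.2).2
  have hval : ∀ a, (⟪v a, T (v a)⟫_ℂ) = a.1 := fun a => by
    rw [hTv, inner_smul_right, inner_self_eq_norm_sq_to_K, hvo.1]; simp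
  have hre : ∀ a : Σ μ : ℂ, w μ, ((a.1.re : ℝ) : ℂ) = a.1 := fun a => by
    have h := hpos.inner_nonneg_right (v a)
    rw [hval, Complex.le_def] at h
    exact Complex.ext (by simp) (by simpa using h.2)
  have ht : (Submodule.span ℂ (Set.range (v ∘ φ)))ᗮ = ⊥ := by rwa [φ.surjective.range_comp]
  refine ⟨HilbertBasis.mkOfOrthogonalEqBot ho ht, fun n => (φ n).1.re, fun n => ?_, ?_, fun n => ?_⟩
  · have := hpos.re_inner_nonneg_right (v (φ n))
    rwa [hval] at this
  · refine squeeze_zero_norm (fun n => ?_) (tendsto_zero_iff_norm_tendsto_zero.1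
      (tendsto_apply_orthonormal hT ho))
    rw [Function.comp_apply, hTv, norm_smul, hvo.1, mul_one, ← hre, Complex.norm_real]
    simp
  · rw [HilbertBasis.coe_mkOfOrthogonalEqBot, Function.comp_apply, hTv, hre]

/-! ### Singular numbers -/

theorem abs_eq_self {T : H →L[ℂ] H} (hT : T.IsPositive) : CFC.abs T = T :=
  CFC.abs_of_nonneg T ((ContinuousLinearMap.nonneg_iff_isPositive T).2 hT)

section singularNumbers

variable {T : H →L[ℂ] H} {b : HilbertBasis ℕ ℂ H} {μ : ℕ → ℝ}

theorem finite_le_of_tendsto (hμt : Tendsto μ atTop (𝓝 0)) {t : ℝ} (ht : 0 < t) :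
    {i | t ≤ μ i}.Finite := by
  obtain ⟨N, hN⟩ := eventually_atTop.1 (hμt.eventually (gt_mem_nhds ht))
  refine (Set.finite_lt_nat N).subset fun i hi => ?_
  by_contra hcon
  exact not_lt.2 hi (hN i (not_lt.1 hcon))

/-- The sum of the eigenspaces for eigenvalues at least `t` is the span of the basis vectors `b i`
with `t ≤ μ i`. -/
theorem eigenvalueCount_eq (hpos : T.IsPositive) (hμt : Tendsto μ atTop (𝓝 0))
    (hTb : ∀ i, T (b i) = (μ i : ℂ) • b i) {t : ℝ} (ht : 0 < t) :
    eigenvalueCount T t = {i | t ≤ μ i}.ncard := by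
  have hfin := finite_le_of_tendsto hμt ht
  have hspan : (⨆ ν ∈ Set.Ici t, Module.End.eigenspace (T : H →ₗ[ℂ] H) (ν : ℂ)) =
      Submodule.span ℂ (Set.range fun i : {i | t ≤ μ i} => b i) := by
    refine le_antisymm (iSup₂_le fun ν hν x hx => ?_) (Submodule.span_le.2 ?_)
    · have hx' : T x = (ν : ℂ) • x := Module.End.mem_eigenspace_iff.1 hx
      have hcoef : ∀ i, i ∉ hfin.toFinset → b.repr x i • b i = 0 := by
        intro i hi
        rw [Set.Finite.mem_toFinset, Set.mem_ofPred_eq, not_le] at hi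
        have h1 : ⟪T (b i), x⟫_ℂ = ⟪b i, T x⟫_ℂ := hpos.inner_left_eq_inner_right _ _
        rw [hTb, hx', inner_smul_left, inner_smul_right, Complex.conj_ofReal] at h1
        have hne : (μ i : ℂ) - ν ≠ 0 := by
          rw [sub_ne_zero]
          exact_mod_cast (hi.trans_le hν).ne
        have : ((μ i : ℂ) - ν) * ⟪b i, x⟫_ℂ = 0 := by rw [sub_mul, h1, sub_self]
        rw [b.repr_apply_apply, (mul_eq_zero.1 this).resolve_left hne, zero_smul]
      rw [(b.hasSum_repr x).unique (hasSum_sum_of_ne_finset_zero hcoef)]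
      refine Submodule.sum_mem _ fun i hi => Submodule.smul_mem _ _ (Submodule.subset_span ?_)
      exact ⟨⟨i, hfin.mem_toFinset.1 hi⟩, rfl⟩
    · rintro _ ⟨i, rfl⟩
      exact Submodule.mem_iSup_of_mem (μ i) (Submodule.mem_iSup_of_mem i.2
        (Module.End.mem_eigenspace_iff.2 (hTb i)))
  have := hfin.fintype
  have hli : LinearIndependent ℂ fun i : {i | t ≤ μ i} => b i :=
    b.orthonormal.linearIndependent.comp _ Subtype.val_injective
  rw [eigenvalueCount, abs_eq_self hpos, hspan, finrank_span_eq_card hli,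
    ← Nat.card_eq_fintype_card]
  rfl

/-- The singular numbers of a positive operator with an orthonormal basis of eigenvectors are its
eigenvalues in decreasing order. -/
theorem singularNumbers_eq (hpos : T.IsPositive) (hμ0 : ∀ i, 0 ≤ μ i)
    (hμt : Tendsto μ atTop (𝓝 0)) (hTb : ∀ i, T (b i) = (μ i : ℂ) • b i) {σ : ℕ → ℕ}
    (hσ : Function.Injective σ) (hanti : Antitone (μ ∘ σ))
    (hσ0 : ∀ i, i ∉ Set.range σ → μ i = 0) : singularNumbers T = μ ∘ σ := by
  have hcount : ∀ t > 0, ∀ n, n < eigenvalueCount T t ↔ t ≤ μ (σ n) := by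
    intro t ht n
    have hfin := finite_le_of_tendsto hμt ht
    have himage : {i | t ≤ μ i} = σ '' {k | t ≤ μ (σ k)} := by
      ext i
      constructor
      · intro hi
        by_cases hr : i ∈ Set.range σ
        · obtain ⟨k, rfl⟩ := hr
          exact ⟨k, hi, rfl⟩
        · exact absurd (hσ0 i hr ▸ hi : t ≤ 0) (not_le.2 ht)
      · rintro ⟨k, hk, rfl⟩
        exact hk
    have hfin' : {k | t ≤ μ (σ k)}.Finite := by
      rw [himage] at hfin
      exact Set.Finite.of_finite_image hfin hσ.injOn
    rw [eigenvalueCount_eq hpos hμt hTb ht, himage, Set.ncard_image_of_injective _ hσ]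
    constructor
    · intro hn
      by_contra hcon
      have hsub : {k | t ≤ μ (σ k)} ⊆ Set.Iio n := fun k hk => by
        by_contra hkn
        exact hcon (le_trans hk (hanti (not_lt.1 hkn)))
      have := Set.ncard_le_ncard hsub (Set.finite_Iio n)
      rw [Set.ncard_Iio_nat] at this
      omega
    · intro hn
      have hsub : Set.Iic n ⊆ {k | t ≤ μ (σ k)} := fun k hk => le_trans hn (hanti hk)
      have := Set.ncard_le_ncard hsub hfin'
      rw [Set.ncard_Iic_nat] at this
      omega
  funext n
  have hset : {t : ℝ | 0 < t ∧ n < eigenvalueCount T t} = Set.Ioc 0 (μ (σ n)) := by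
    ext t
    exact and_congr_right fun ht => hcount t ht n
  rw [singularNumbers, hset, Function.comp_apply]
  rcases (hμ0 (σ n)).lt_or_eq with h | h
  · exact csSup_Ioc h
  · rw [← h, Set.Ioc_self, Real.sSup_empty]

end singularNumbers

/-- A diagonal operator whose entries tend to `0` is the norm limit of its finite truncations. -/
theorem isCompactOperator_diag (e : HilbertBasis ℕ ℂ H) (ρ : lp (fun _ : ℕ => ℂ) ∞)
    (hρ : Tendsto (fun n => ρ n) atTop (𝓝 0)) : IsCompactOperator (diag e ρ) := by
  let F : ℕ → H →L[ℂ] H := fun N =>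
    ∑ n ∈ Finset.range N, ρ n • (ContinuousLinearMap.toSpanSingleton ℂ (e n) ∘L innerSL ℂ (e n))
  have hF : ∀ N, IsCompactOperator (F N) := fun N => by
    refine (compactOperator (RingHom.id ℂ) H H).sum_mem fun n _ => ?_
    have h : IsCompactOperator (ContinuousLinearMap.toSpanSingleton ℂ (e n)) :=
      isCompactOperator_of_locallyCompactSpace_rng _
    exact (h.comp_clm (innerSL ℂ (e n))).smul (S := ℂ) (ρ n)
  refine isCompactOperator_of_tendsto (F := F) (l := atTop) ?_ (Eventually.of_forall hF)
  rw [Metric.tendsto_atTop]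
  intro ε hε
  obtain ⟨N, hN⟩ := Metric.tendsto_atTop.1 hρ (ε / 2) (half_pos hε)
  refine ⟨N, fun M hM => ?_⟩
  have hmem : Memℓp (fun n => if n < M then 0 else ρ n) ∞ := by
    refine memℓp_infty ⟨‖ρ‖, ?_⟩
    rintro _ ⟨n, rfl⟩
    dsimp only
    split_ifs
    · simp
    · exact lp.norm_apply_le_norm ENNReal.top_ne_zero ρ n
  let τ : lp (fun _ : ℕ => ℂ) ∞ := ⟨_, hmem⟩
  have hdiff : diag e ρ - F M = diag e τ := by
    refine ContinuousLinearMap.ext_on (s := Set.range e) ?_ ?_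
    · exact Submodule.dense_iff_topologicalClosure_eq_top.2 e.dense_span
    · rintro _ ⟨k, rfl⟩
      have hτ : τ k = if k < M then 0 else ρ k := rfl
      have : ∀ n, ⟪e n, e k⟫_ℂ = if n = k then 1 else 0 := fun n =>
        orthonormal_iff_ite.1 e.orthonormal n k
      simp only [F, sub_apply, diag_apply_basis, hτ,
        sum_apply, smul_apply,
        ContinuousLinearMap.comp_apply, innerSL_apply_apply, this,
        ContinuousLinearMap.toSpanSingleton_apply, ite_smul, one_smul, zero_smul, smul_ite,
        smul_zero, Finset.sum_ite_eq', Finset.mem_range]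
      split_ifs <;> simp
  rw [dist_eq_norm, norm_sub_rev, hdiff]
  refine ((norm_diag_le e τ).trans (lp.norm_le_of_forall_le (half_pos hε).le fun n => ?_)).trans_lt
    (half_lt_self hε)
  change ‖if n < M then 0 else ρ n‖ ≤ _
  split_ifs with h
  · simpa using (half_pos hε).le
  · have := hN n (by omega)
    rw [dist_zero_right] at this
    exact this.le

end SchurHorn

/-! ### Quadratic forms in an eigenbasis -/

namespace SchurHorn

variable {H : Type*} [NormedAddCommGroup H] [InnerProductSpace ℂ H]

theorem inner_apply_self_eq {A : H →L[ℂ] H} (hA : A.IsPositive) (y : H) :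
    ⟪y, A y⟫_ℂ = ((⟪y, A y⟫_ℂ).re : ℂ) := by
  have h := hA.inner_nonneg_right y
  rw [Complex.le_def] at h
  exact Complex.ext (by simp) (by simpa using h.2.symm)

theorem hasSum_norm_inner_sq (b : HilbertBasis ℕ ℂ H) (y : H) :
    HasSum (fun k => ‖⟪b k, y⟫_ℂ‖ ^ 2) (‖y‖ ^ 2) := by
  have := Complex.hasSum_re (b.hasSum_inner_mul_inner y y)
  rw [inner_self_eq_norm_sq_to_K] at this
  convert this using 1
  · funext k
    rw [← inner_conj_symm y, Complex.conj_mul', ← Complex.ofReal_pow, Complex.ofReal_re]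
  · exact_mod_cast (Complex.ofReal_re (‖y‖ ^ (2 : ℕ))).symm

section eigenbasis

variable {A : H →L[ℂ] H} {b : HilbertBasis ℕ ℂ H} {μ : ℕ → ℝ}

theorem hasSum_re_inner (hA : A.IsPositive) (hAb : ∀ i, A (b i) = (μ i : ℂ) • b i) (y : H) :
    HasSum (fun k => μ k * ‖⟪b k, y⟫_ℂ‖ ^ 2) (⟪y, A y⟫_ℂ).re := by
  refine (Complex.hasSum_re (b.hasSum_inner_mul_inner y (A y))).congr_fun fun k => ?_
  rw [← hA.inner_left_eq_inner_right (b k), hAb, inner_smul_left, Complex.conj_ofReal,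
    mul_left_comm, ← inner_conj_symm y, Complex.conj_mul', ← Complex.ofReal_pow,
    ← Complex.ofReal_mul, Complex.ofReal_re]

/-- **Ky Fan's inequality**. The hypotheses on `y` say that the numbers `c k = ∑ n ∈ F, |⟨b k, y
n⟩|²` are at most `1` and have a sum of at most `#F`; among such weights, `∑ μ k * c k` is largest when
the weight is `1` at the `#F` largest values of `μ`. -/
theorem sum_re_inner_le (hA : A.IsPositive) (hAb : ∀ i, A (b i) = (μ i : ℂ) • b i)
    (hμ0 : ∀ i, 0 ≤ μ i) {σ : ℕ → ℕ} (hσ : Function.Injective σ) (hanti : Antitone (μ ∘ σ))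
    (hσ0 : ∀ i, i ∉ Set.range σ → μ i = 0) (F : Finset ℕ) (y : ℕ → H)
    (hy : ∀ n ∈ F, ‖y n‖ ≤ 1) (hb : ∀ k, ∑ n ∈ F, ‖⟪b k, y n⟫_ℂ‖ ^ 2 ≤ 1) :
    ∑ n ∈ F, (⟪y n, A (y n)⟫_ℂ).re ≤ ∑ j ∈ Finset.range F.card, μ (σ j) := by
  classical
  set N := F.card
  set s := μ (σ N)
  have h1 : HasSum (fun k => ∑ n ∈ F, μ k * ‖⟪b k, y n⟫_ℂ‖ ^ 2) (∑ n ∈ F, (⟪y n, A (y n)⟫_ℂ).re) :=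
    hasSum_sum fun n _ => hasSum_re_inner hA hAb (y n)
  have h2 : HasSum (fun k => ∑ n ∈ F, ‖⟪b k, y n⟫_ℂ‖ ^ 2) (∑ n ∈ F, ‖y n‖ ^ 2) :=
    hasSum_sum fun n _ => hasSum_norm_inner_sq b (y n)
  let G := (Finset.range N).image σ
  have h3 : HasSum (fun k => if k ∈ G then μ k - s else 0) (∑ k ∈ G, (μ k - s)) := by
    have := hasSum_sum_of_ne_finset_zero (s := G) (f := fun k => if k ∈ G then μ k - s else 0)
      (L := SummationFilter.unconditional ℕ) fun k hk => if_neg hk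
    rwa [Finset.sum_congr rfl fun k hk => if_pos hk] at this
  have h4 := hasSum_le (fun k => ?_) h1 ((h2.mul_left s).add h3)
  · refine h4.trans ?_
    rw [Finset.sum_image hσ.injOn, Finset.sum_sub_distrib]
    have h5 : ∑ n ∈ F, ‖y n‖ ^ 2 ≤ N := by
      calc ∑ n ∈ F, ‖y n‖ ^ 2 ≤ ∑ n ∈ F, (1 : ℝ) :=
            Finset.sum_le_sum fun n hn => pow_le_one₀ (norm_nonneg _) (hy n hn)
        _ = N := by simp [N]
    have h6 := mul_le_mul_of_nonneg_left h5 (hμ0 (σ N))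
    simp only [Finset.sum_const, Finset.card_range, nsmul_eq_mul]
    simp only [s]
    linarith
  · rw [← Finset.mul_sum]
    have hc0 : 0 ≤ ∑ n ∈ F, ‖⟪b k, y n⟫_ℂ‖ ^ 2 := Finset.sum_nonneg fun n _ => sq_nonneg _
    have hc1 := hb k
    -- termwise `μ k * c k ≤ s * c k + (μ k - s)⁺`, as `c k ≤ 1`
    split_ifs with hk
    · obtain ⟨j, hj, rfl⟩ := Finset.mem_image.1 hk
      have : s ≤ μ (σ j) := hanti (Finset.mem_range.1 hj).le
      nlinarith
    · have : μ k ≤ s := by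
        by_cases hr : k ∈ Set.range σ
        · obtain ⟨j, rfl⟩ := hr
          refine hanti (not_lt.1 fun hj => hk ?_)
          exact Finset.mem_image_of_mem _ (Finset.mem_range.2 hj)
        · rw [hσ0 k hr]; exact hμ0 _
      nlinarith

theorem apply_eq_zero_of_inner_eq_zero (hA : A.IsPositive)
    (hAb : ∀ i, A (b i) = (μ i : ℂ) • b i) {σ : ℕ → ℕ}
    (hσ0 : ∀ i, i ∉ Set.range σ → μ i = 0) {x : H} (hx : ∀ i, ⟪b (σ i), x⟫_ℂ = 0) : A x = 0 := by
  refine (b.hasSum_repr (A x)).unique ?_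
  convert hasSum_zero with i
  rw [b.repr_apply_apply, ← hA.inner_left_eq_inner_right, hAb, inner_smul_left]
  by_cases hi : i ∈ Set.range σ
  · obtain ⟨j, rfl⟩ := hi
    rw [hx, mul_zero, zero_smul]
  · rw [hσ0 i hi]; simp

variable [CompleteSpace H]

/-- The trace of `V A V*`, computed in the basis `e` and in the eigenbasis `b` of `A`: the order of
summation in `∑ n, ∑ k, μ k |⟨e n, V b_k⟩|²` is exchanged. -/
theorem tsum_ofReal_conj (e : HilbertBasis ℕ ℂ H) (hA : A.IsPositive)
    (hAb : ∀ i, A (b i) = (μ i : ℂ) • b i) (hμ0 : ∀ i, 0 ≤ μ i) (V : H →L[ℂ] H) :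
    ∑' n, ENNReal.ofReal (⟪ContinuousLinearMap.adjoint V (e n),
        A (ContinuousLinearMap.adjoint V (e n))⟫_ℂ).re =
      ∑' k, ENNReal.ofReal (μ k * ‖V (b k)‖ ^ 2) := by
  have h1 : ∀ n, ENNReal.ofReal (⟪ContinuousLinearMap.adjoint V (e n),
        A (ContinuousLinearMap.adjoint V (e n))⟫_ℂ).re =
      ∑' k, ENNReal.ofReal (μ k * ‖⟪e n, V (b k)⟫_ℂ‖ ^ 2) := by
    intro n
    have h := hasSum_re_inner hA hAb (ContinuousLinearMap.adjoint V (e n))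
    rw [← h.tsum_eq, ENNReal.ofReal_tsum_of_nonneg
      (fun k => mul_nonneg (hμ0 k) (sq_nonneg _)) h.summable]
    refine tsum_congr fun k => ?_
    rw [ContinuousLinearMap.adjoint_inner_right, norm_inner_symm]
  have h2 : ∀ k, ENNReal.ofReal (μ k * ‖V (b k)‖ ^ 2) =
      ∑' n, ENNReal.ofReal (μ k * ‖⟪e n, V (b k)⟫_ℂ‖ ^ 2) := by
    intro k
    have h := (hasSum_norm_inner_sq e (V (b k))).mul_left (μ k)
    rw [← h.tsum_eq, ENNReal.ofReal_tsum_of_nonneg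
      (fun k => mul_nonneg (hμ0 _) (sq_nonneg _)) h.summable]
  rw [tsum_congr h1, tsum_congr h2, ENNReal.tsum_comm]

theorem trace_eq_tsum (e : HilbertBasis ℕ ℂ H) (hA : A.IsPositive)
    (hAb : ∀ i, A (b i) = (μ i : ℂ) • b i) (hμ0 : ∀ i, 0 ≤ μ i) :
    trace e A = ∑' k, ENNReal.ofReal (μ k) := by
  have hid : ContinuousLinearMap.adjoint (ContinuousLinearMap.id ℂ H) =
      ContinuousLinearMap.id ℂ H := star_one _
  have := tsum_ofReal_conj e hA hAb hμ0 (ContinuousLinearMap.id ℂ H)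
  rw [hid] at this
  simpa [trace, b.orthonormal.1] using this

end eigenbasis

/-! ### Partial isometries -/

section partialIsometry

variable [CompleteSpace H]
variable {A V : H →L[ℂ] H}

theorem rangeProjectionSup_eq_zero (hA : A.IsPositive) {x : H} (hx : A x = 0) :
    rangeProjectionSup A x = 0 := by
  rw [rangeProjectionSup, Submodule.starProjection_apply_eq_zero_iff,
    Submodule.orthogonal_closure, hA.isSelfAdjoint.adjoint_eq, sup_idem, Submodule.mem_orthogonal]
  rintro _ ⟨y, rfl⟩
  change ⟪A y, x⟫_ℂ = 0
  rw [hA.inner_left_eq_inner_right, hx, inner_zero_right]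

theorem rangeProjectionSup_apply_range (A : H →L[ℂ] H) (x : H) :
    rangeProjectionSup A (A x) = A x := by
  rw [rangeProjectionSup, Submodule.starProjection_eq_self_iff]
  exact Submodule.le_topologicalClosure _ (Submodule.mem_sup_left ⟨x, rfl⟩)

theorem apply_rangeProjectionSup (hA : A.IsPositive) (x : H) :
    A (rangeProjectionSup A x) = A x := by
  refine ext_inner_left ℂ fun y => ?_
  rw [← hA.inner_left_eq_inner_right, ← hA.inner_left_eq_inner_right]
  conv_rhs => rw [← rangeProjectionSup_apply_range A y]
  exact (Submodule.inner_starProjection_left_eq_right _ _ _).symm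

theorem norm_sq_eq_of_adjoint_comp (hV : ContinuousLinearMap.adjoint V ∘L V = rangeProjectionSup A)
    (x : H) : ‖V x‖ ^ 2 = ‖rangeProjectionSup A x‖ ^ 2 := by
  have h1 : ⟪V x, V x⟫_ℂ = ⟪rangeProjectionSup A x, rangeProjectionSup A x⟫_ℂ := by
    rw [← ContinuousLinearMap.adjoint_inner_right, ← ContinuousLinearMap.comp_apply, hV]
    conv_rhs => rw [rangeProjectionSup, Submodule.inner_starProjection_left_eq_right]
    rw [rangeProjectionSup, Submodule.starProjection_eq_self_iff.2
      (Submodule.starProjection_apply_mem _ _)]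
  rw [inner_self_eq_norm_sq_to_K, inner_self_eq_norm_sq_to_K] at h1
  exact_mod_cast h1

theorem norm_apply_le (hV : ContinuousLinearMap.adjoint V ∘L V = rangeProjectionSup A) (x : H) :
    ‖V x‖ ≤ ‖x‖ := by
  have h := norm_sq_eq_of_adjoint_comp hV x
  rw [pow_left_inj₀ (norm_nonneg _) (norm_nonneg _) two_ne_zero] at h
  rw [h]
  exact Submodule.norm_starProjection_apply_le _ x

/-- An operator `V` for which `V* V` is a projection is a partial isometry. -/
theorem isPartialIsometry_of_adjoint_comp
    (hV : ContinuousLinearMap.adjoint V ∘L V = rangeProjectionSup A) : IsPartialIsometry V := by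
  intro x hx
  have h := norm_sq_eq_of_adjoint_comp hV
  have hidem : ∀ y, rangeProjectionSup A (rangeProjectionSup A y) = rangeProjectionSup A y :=
    fun y => Submodule.starProjection_eq_self_iff.2 (Submodule.starProjection_apply_mem _ _)
  have hker : V (x - rangeProjectionSup A x) = 0 := by
    have := h (x - rangeProjectionSup A x)
    rw [map_sub (rangeProjectionSup A), hidem, sub_self, norm_zero] at this
    simpa using this
  have h1 : ⟪x - rangeProjectionSup A x, x⟫_ℂ = 0 := (Submodule.mem_orthogonal _ _).1 hx _ hker
  have h2 : ⟪x - rangeProjectionSup A x, rangeProjectionSup A x⟫_ℂ = 0 :=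
    Submodule.starProjection_inner_eq_zero x _ (Submodule.starProjection_apply_mem _ _)
  have h3 : x - rangeProjectionSup A x = 0 := by
    rw [← inner_self_eq_zero (𝕜 := ℂ), inner_sub_right, h1, h2, sub_zero]
  rw [← pow_left_inj₀ (norm_nonneg _) (norm_nonneg _) two_ne_zero, h x, ← sub_eq_zero.1 h3]

/-- The partial isometry `W` that carries one orthonormal sequence to another one. The last property
says that `W* W` is the projection to the closed span of `g`. -/
theorem exists_partialIsometry {g h : ℕ → H} (hg : Orthonormal ℂ g) (hh : Orthonormal ℂ h) :
    ∃ W : H →L[ℂ] H, (∀ j, ContinuousLinearMap.adjoint W (h j) = g j) ∧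
      (∀ x, (∀ j, ⟪h j, x⟫_ℂ = 0) → ContinuousLinearMap.adjoint W x = 0) ∧
      ∀ x j, ⟪g j, ContinuousLinearMap.adjoint W (W x) - x⟫_ℂ = 0 := by
  let U : ∀ {v : ℕ → H}, Orthonormal ℂ v → lp (fun _ : ℕ => ℂ) 2 →L[ℂ] H :=
    fun hv => hv.orthogonalFamily.linearIsometry.toContinuousLinearMap
  have hU : ∀ {v : ℕ → H} (hv : Orthonormal ℂ v) (j : ℕ), U hv (lp.single 2 j (1 : ℂ)) = v j := by
    intro v hv j
    have := hv.orthogonalFamily.linearIsometry_apply_single (i := j) (1 : ℂ)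
    rw [LinearIsometry.toSpanSingleton_apply, one_smul] at this
    exact this
  have hUU : ∀ {v : ℕ → H} (hv : Orthonormal ℂ v) (f),
      ContinuousLinearMap.adjoint (U hv) (U hv f) = f := by
    intro v hv f
    refine ext_inner_left ℂ fun f' => ?_
    rw [ContinuousLinearMap.adjoint_inner_right]
    exact LinearIsometry.inner_map_map _ _ _
  refine ⟨U hh ∘L ContinuousLinearMap.adjoint (U hg), fun j => ?_, fun x hx => ?_, fun x j => ?_⟩
  all_goals rw [ContinuousLinearMap.adjoint_comp, ContinuousLinearMap.adjoint_adjoint]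
  · rw [ContinuousLinearMap.comp_apply, ← hU hh j, hUU hh, hU hg j]
  · have : ContinuousLinearMap.adjoint (U hh) x = 0 := by
      ext j
      have := hx j
      rw [← hU hh j, ← ContinuousLinearMap.adjoint_inner_right, lp.inner_single_left] at this
      simpa using this
    rw [ContinuousLinearMap.comp_apply, this, map_zero]
  · simp only [ContinuousLinearMap.comp_apply, hUU hh]
    rw [← hU hg j, ← ContinuousLinearMap.adjoint_inner_right, map_sub, hUU hg, sub_self,
      inner_zero_right]

end partialIsometry

end SchurHorn

/-! ### The two inclusions -/

namespace SchurHorn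

variable {H : Type*} [NormedAddCommGroup H] [InnerProductSpace ℂ H] [CompleteSpace H]

theorem exists_diag_real {e : HilbertBasis ℕ ℂ H} {B : H →L[ℂ] H}
    (hB : B ∈ diagonalOperators e ∩ positiveCompacts H) :
    ∃ (ρ : lp (fun _ : ℕ => ℂ) ∞) (d : ℕ → ℝ), B = diag e ρ ∧ (∀ n, ρ n = d n) ∧
      (∀ n, 0 ≤ d n) ∧ Tendsto d atTop (𝓝 0) := by
  obtain ⟨⟨ρ, rfl⟩, hcomp, hpos⟩ := hB
  have hρ : ∀ n, ρ n = ⟪e n, diag e ρ (e n)⟫_ℂ := fun n => by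
    rw [inner_diag, inner_self_eq_norm_sq_to_K, e.orthonormal.1]; simp
  have hreal : ∀ n, ρ n = ((ρ n).re : ℂ) := fun n => by
    rw [hρ]; exact inner_apply_self_eq hpos _
  refine ⟨ρ, fun n => (ρ n).re, rfl, hreal, fun n => ?_, ?_⟩
  · have := hpos.re_inner_nonneg_right (e n)
    rwa [← hρ] at this
  · refine squeeze_zero_norm (fun n => ?_) (tendsto_zero_iff_norm_tendsto_zero.1
      (tendsto_apply_orthonormal hcomp e.orthonormal))
    rw [diag_apply_basis, norm_smul, e.orthonormal.1, mul_one]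
    exact Complex.abs_re_le_norm _

section tsum

variable {d : ℕ → ℝ} {σ : ℕ → ℕ}

theorem tsum_ofReal_comp (hσ : Function.Injective σ) (hσ0 : ∀ n, n ∉ Set.range σ → d n = 0) :
    ∑' n, ENNReal.ofReal (d n) = ∑' n, ENNReal.ofReal (d (σ n)) := by
  refine (hσ.tsum_eq fun n hn => ?_).symm
  by_contra hcon
  exact hn (by simp [hσ0 n hcon])

theorem summable_of_tsum_ofReal_lt_top (h0 : ∀ n, 0 ≤ d n)
    (h : ∑' n, ENNReal.ofReal (d n) < ∞) : Summable d := by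
  have := ENNReal.summable_toReal h.ne
  simpa only [ENNReal.toReal_ofReal (h0 _)] using this

end tsum

theorem liminf_sum_sub_eq_zero {ξ η : ℕ → ℝ} (hξ0 : ∀ n, 0 ≤ ξ n) (hη0 : ∀ n, 0 ≤ η n)
    (h : ∑' n, ENNReal.ofReal (ξ n) = ∑' n, ENNReal.ofReal (η n))
    (hfin : ∑' n, ENNReal.ofReal (η n) < ∞) :
    liminf (fun n : ℕ => ((∑ j ∈ Finset.range n, (η j - ξ j) : ℝ) : EReal)) atTop = 0 := by
  have hξ := summable_of_tsum_ofReal_lt_top hξ0 (h ▸ hfin)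
  have hη := summable_of_tsum_ofReal_lt_top hη0 hfin
  rw [← ENNReal.ofReal_tsum_of_nonneg hξ0 hξ, ← ENNReal.ofReal_tsum_of_nonneg hη0 hη,
    ENNReal.ofReal_eq_ofReal_iff (tsum_nonneg hξ0) (tsum_nonneg hη0)] at h
  have hlim := (hη.hasSum.sub hξ.hasSum).tendsto_sum_nat
  rw [h, sub_self] at hlim
  exact ((continuous_coe_real_ereal.tendsto 0).comp hlim).liminf_eq

theorem exhausts_of_liminf {ξ η : ℕ → ℝ}
    (h : liminf (fun n : ℕ => ((∑ j ∈ Finset.range n, (η j - ξ j) : ℝ) : EReal)) atTop = 0) :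
    Exhausts ξ η := by
  refine Or.inr fun ε hε => ?_
  have hlt : liminf (fun n : ℕ => ((∑ j ∈ Finset.range n, (η j - ξ j) : ℝ) : EReal)) atTop
      < (ε : EReal) := by rw [h]; exact_mod_cast hε
  refine (frequently_lt_of_liminf_lt (by isBoundedDefault) hlt).mono fun n hn => ?_
  rw [← Finset.sum_sub_distrib]
  exact_mod_cast hn

/-- Necessity: the properties of the diagonal of an operator in the partial isometry orbit of
`A`. -/
theorem expectation_mem {e : HilbertBasis ℕ ℂ H} {A S : H →L[ℂ] H} (hA : A ∈ positiveCompacts H)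
    (hS : S ∈ partialIsometryOrbit A) :
    expectation e S ∈ diagonalOperators e ∩ positiveCompacts H ∧
      Majorized (singularNumbers (expectation e S)) (singularNumbers A) ∧
      trace e (expectation e S) = trace e A ∧
      (trace e A < ∞ →
        StronglyMajorized (singularNumbers (expectation e S)) (singularNumbers A)) := by
  obtain ⟨hcomp, hpos⟩ := hA
  obtain ⟨V, -, hV, rfl⟩ := hS
  set S := V ∘L A ∘L ContinuousLinearMap.adjoint V with hSdef
  obtain ⟨b, μ, hμ0, hμt, hAb⟩ := exists_eigenbasis e hcomp hpos
  obtain ⟨σ, hσ, hσa, hσ0⟩ := exists_sort hμ0 hμt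
  let y : ℕ → H := fun n => ContinuousLinearMap.adjoint V (e n)
  let d : ℕ → ℝ := diagValue A y
  have hinner : ∀ n, ⟪e n, S (e n)⟫_ℂ = ⟪y n, A (y n)⟫_ℂ := fun n => by
    rw [hSdef, ContinuousLinearMap.comp_apply, ContinuousLinearMap.comp_apply,
      ← ContinuousLinearMap.adjoint_inner_left]
  have hρ : ∀ n, mainDiagonal e S n = d n := fun n => by
    rw [mainDiagonal_apply, hinner, inner_apply_self_eq hpos]; rfl
  have hd0 : ∀ n, 0 ≤ d n := diagValue_nonneg hpos y
  have hScomp : IsCompactOperator S := (hcomp.comp_clm _).clm_comp V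
  have hdt : Tendsto d atTop (𝓝 0) := by
    refine squeeze_zero_norm (fun n => ?_) (tendsto_zero_iff_norm_tendsto_zero.1
      (tendsto_apply_orthonormal hScomp e.orthonormal))
    rw [← Complex.norm_real, ← hρ, mainDiagonal_apply]
    refine (norm_inner_le_norm _ _).trans ?_
    rw [e.orthonormal.1, one_mul]
  have hBpos : (expectation e S).IsPositive := isPositive_diag e _ hd0 hρ
  have hBcomp : IsCompactOperator (expectation e S) := by
    refine isCompactOperator_diag e _ ?_
    simp only [hρ]
    exact_mod_cast (Complex.continuous_ofReal.tendsto 0).comp hdt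
  have hBe : ∀ n, expectation e S (e n) = (d n : ℂ) • e n := fun n => by
    rw [expectation, diag_apply_basis, hρ]
  obtain ⟨τ, hτ, hτa, hτ0⟩ := exists_sort hd0 hdt
  have hsA := singularNumbers_eq hpos hμ0 hμt hAb hσ hσa hσ0
  have hsB := singularNumbers_eq hBpos hd0 hdt hBe hτ hτa hτ0
  have hVle := norm_apply_le hV
  have hmaj : Majorized (d ∘ τ) (μ ∘ σ) := by
    intro n
    have hy1 : ∀ m, ‖y m‖ ≤ 1 := fun m => by
      have h1 : ‖V‖ ≤ 1 := V.opNorm_le_bound zero_le_one fun x => by simpa using hVle x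
      calc ‖y m‖ ≤ ‖ContinuousLinearMap.adjoint V‖ * ‖e m‖ := ContinuousLinearMap.le_opNorm _ _
        _ = ‖V‖ := by rw [e.orthonormal.1, mul_one, LinearIsometryEquiv.norm_map]
        _ ≤ 1 := h1
    have := sum_re_inner_le hpos hAb hμ0 hσ hσa hσ0 ((Finset.range n).image τ) y
      (fun m _ => hy1 m) fun k => by
        calc ∑ m ∈ (Finset.range n).image τ, ‖⟪b k, y m⟫_ℂ‖ ^ 2
            = ∑ m ∈ (Finset.range n).image τ, ‖⟪e m, V (b k)⟫_ℂ‖ ^ 2 :=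
              Finset.sum_congr rfl fun m _ => by
                rw [ContinuousLinearMap.adjoint_inner_right, norm_inner_symm]
          _ ≤ ‖V (b k)‖ ^ 2 := e.orthonormal.sum_inner_products_le _
          _ ≤ 1 := pow_le_one₀ (norm_nonneg _) ((hVle _).trans_eq (b.orthonormal.1 k))
    rw [Finset.card_image_of_injective _ hτ, Finset.card_range, Finset.sum_image hτ.injOn] at this
    exact this
  have htB : trace e (expectation e S) = ∑' n, ENNReal.ofReal (d n) :=
    trace_eq_tsum e hBpos hBe hd0
  have htA : trace e A = ∑' n, ENNReal.ofReal (μ n) := trace_eq_tsum e hpos hAb hμ0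
  have htr : ∑' n, ENNReal.ofReal (d n) = ∑' n, ENNReal.ofReal (μ n) := by
    refine (tsum_ofReal_conj e hpos hAb hμ0 V).trans (tsum_congr fun k => ?_)
    rcases eq_or_ne (μ k) 0 with h | h
    · rw [h, zero_mul]
    · have hk : rangeProjectionSup A (b k) = b k := by
        have h1 := rangeProjectionSup_apply_range A (b k)
        rw [hAb, map_smul] at h1
        exact smul_right_injective H (Complex.ofReal_ne_zero.2 h) h1
      rw [norm_sq_eq_of_adjoint_comp hV, hk, b.orthonormal.1, one_pow, mul_one]
  refine ⟨⟨⟨_, rfl⟩, hBcomp, hBpos⟩, by rwa [hsA, hsB], by rw [htB, htA, htr], fun hfin => ?_⟩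
  rw [hsA, hsB]
  refine ⟨hmaj, liminf_sum_sub_eq_zero (fun n => hd0 _) (fun n => hμ0 _) ?_ ?_⟩
  · simp only [Function.comp_apply]
    rw [← tsum_ofReal_comp hτ hτ0, ← tsum_ofReal_comp hσ hσ0, htr]
  · simp only [Function.comp_apply]
    rwa [← tsum_ofReal_comp hσ hσ0, ← htA]

/-- Sufficiency: a majorized diagonal is realized in the partial isometry orbit of `A` if nothing is
lost at infinity. -/
theorem mem_expectation_image {e : HilbertBasis ℕ ℂ H} {A B : H →L[ℂ] H}
    (hA : A ∈ positiveCompacts H) (hB : B ∈ diagonalOperators e ∩ positiveCompacts H)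
    (hmaj : Majorized (singularNumbers B) (singularNumbers A))
    (hex : trace e B < ∞ → Exhausts (singularNumbers B) (singularNumbers A)) :
    B ∈ expectation e '' partialIsometryOrbit A := by
  have hBpos := hB.2.2
  obtain ⟨ρ, d, rfl, hρ, hd0, hdt⟩ := exists_diag_real hB
  obtain ⟨hcomp, hpos⟩ := hA
  obtain ⟨b, μ, hμ0, hμt, hAb⟩ := exists_eigenbasis e hcomp hpos
  obtain ⟨σ, hσ, hσa, hσ0⟩ := exists_sort hμ0 hμt
  obtain ⟨τ, hτ, hτa, hτ0⟩ := exists_sort hd0 hdt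
  have hBe : ∀ n, diag e ρ (e n) = (d n : ℂ) • e n := fun n => by rw [diag_apply_basis, hρ]
  have hsA := singularNumbers_eq hpos hμ0 hμt hAb hσ hσa hσ0
  have hsB := singularNumbers_eq hBpos hd0 hdt hBe hτ hτa hτ0
  have htB : trace e (diag e ρ) = ∑' n, ENNReal.ofReal (d (τ n)) :=
    (trace_eq_tsum e hBpos hBe hd0).trans (tsum_ofReal_comp hτ hτ0)
  rw [hsA, hsB] at hmaj hex
  have htend : ∀ {π : ℕ → ℕ} {w : ℕ → ℝ}, Function.Injective π → Tendsto w atTop (𝓝 0) →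
      Tendsto (w ∘ π) atTop (𝓝 0) := fun {π w} hπ hw => by
    have := hπ.tendsto_cofinite
    rw [Nat.cofinite_eq_atTop] at this
    exact hw.comp this
  have hex' : Exhausts (d ∘ τ) (μ ∘ σ) := by
    by_cases hs : Summable (d ∘ τ)
    · refine hex ?_
      rw [htB, ← ENNReal.ofReal_tsum_of_nonneg (fun n => hd0 (τ n)) hs]
      exact ENNReal.ofReal_lt_top
    · exact Or.inl hs
  have hval : diagValue A (b ∘ σ) = μ ∘ σ := by
    funext k
    rw [diagValue, Function.comp_apply, hAb, inner_smul_right, inner_self_eq_norm_sq_to_K,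
      b.orthonormal.1]
    simp
  have hstage : Stage A (d ∘ τ) 0 (b ∘ σ) := by
    refine ⟨b.orthonormal.comp σ hσ, fun x hx => apply_eq_zero_of_inner_eq_zero hpos hAb hσ0 hx,
      fun j hj => absurd hj (Nat.not_lt_zero j), fun i _ j _ hij => ?_, ?_, ?_⟩
    · rw [Function.comp_apply, Function.comp_apply, hAb, inner_smul_right,
        b.orthonormal.2 (hσ.ne hij), mul_zero]
    · rw [hval]; exact htend hσ hμt
    · rw [hval]; exact hmaj
  obtain ⟨g, hg, hgd, hgt⟩ := hstage.exists_orthonormal hpos hτa (fun n => hd0 _)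
    (htend hτ hdt) (by rwa [hval])
  obtain ⟨W, hW1, hW2, hW3⟩ := exists_partialIsometry hg (e.orthonormal.comp τ hτ)
  set P := rangeProjectionSup A
  have hPadj : ContinuousLinearMap.adjoint P = P :=
    (isSelfAdjoint_starProjection _).adjoint_eq
  have hV : ContinuousLinearMap.adjoint (W ∘L P) ∘L (W ∘L P) = P := by
    ext x
    rw [ContinuousLinearMap.adjoint_comp, hPadj]
    have h := rangeProjectionSup_eq_zero hpos (hgt _ (hW3 (P x)))
    rw [map_sub, sub_eq_zero] at h
    refine h.trans ?_
    exact Submodule.starProjection_eq_self_iff.2 (Submodule.starProjection_apply_mem _ _)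
  refine ⟨_, ⟨W ∘L P, isPartialIsometry_of_adjoint_comp hV, hV, rfl⟩, ?_⟩
  rw [expectation]
  congr 1
  ext n
  rw [mainDiagonal_apply, hρ, ContinuousLinearMap.comp_apply, ContinuousLinearMap.comp_apply,
    ← ContinuousLinearMap.adjoint_inner_left, ContinuousLinearMap.adjoint_comp, hPadj,
    ContinuousLinearMap.comp_apply, rangeProjectionSup_apply_range,
    ContinuousLinearMap.comp_apply, apply_rangeProjectionSup hpos]
  by_cases hn : n ∈ Set.range τ
  · obtain ⟨j, rfl⟩ := hn
    have h1 : ContinuousLinearMap.adjoint W (e (τ j)) = g j := hW1 j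
    rw [h1, inner_apply_self_eq hpos]
    exact congrArg _ (hgd j)
  · rw [hW2 (e n) fun j => e.orthonormal.2 fun h => hn ⟨j, h⟩, hτ0 n hn]
    simp

end SchurHorn

theorem proposition6p4 {H : Type*} [NormedAddCommGroup H] [InnerProductSpace ℂ H]
    [CompleteSpace H] (e : HilbertBasis ℕ ℂ H) (A : H →L[ℂ] H)
    (hA : A ∈ SchurHorn.positiveCompacts H) :
    (SchurHorn.trace e A = ∞ →
      SchurHorn.expectation e '' SchurHorn.partialIsometryOrbit A =
        {B | B ∈ SchurHorn.diagonalOperators e ∩ SchurHorn.positiveCompacts H ∧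
            SchurHorn.Majorized (SchurHorn.singularNumbers B) (SchurHorn.singularNumbers A)} \
          SchurHorn.traceClass e) ∧
    (SchurHorn.trace e A < ∞ →
      SchurHorn.expectation e '' SchurHorn.partialIsometryOrbit A =
        {B | B ∈ SchurHorn.diagonalOperators e ∩ SchurHorn.positiveCompacts H ∧
            SchurHorn.StronglyMajorized (SchurHorn.singularNumbers B)
              (SchurHorn.singularNumbers A)}) := by
  refine ⟨fun htr => Set.Subset.antisymm ?_ ?_, fun htr => Set.Subset.antisymm ?_ ?_⟩
  · rintro _ ⟨S, hS, rfl⟩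
    obtain ⟨h1, h2, h3, -⟩ := SchurHorn.expectation_mem (e := e) hA hS
    refine ⟨⟨h1, h2⟩, fun h => ?_⟩
    rw [SchurHorn.traceClass, Set.mem_ofPred_eq, SchurHorn.abs_eq_self h1.2.2, h3, htr] at h
    exact lt_irrefl _ h
  · rintro B ⟨⟨hB, hmaj⟩, hnot⟩
    refine SchurHorn.mem_expectation_image hA hB hmaj fun h => absurd ?_ hnot
    rwa [SchurHorn.traceClass, Set.mem_ofPred_eq, SchurHorn.abs_eq_self hB.2.2]
  · rintro _ ⟨S, hS, rfl⟩
    obtain ⟨h1, -, -, h4⟩ := SchurHorn.expectation_mem (e := e) hA hS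
    exact ⟨h1, h4 htr⟩
  · rintro B ⟨hB, hmaj, hlim⟩
    exact SchurHorn.mem_expectation_image hA hB hmaj fun _ => SchurHorn.exhausts_of_liminf hlim
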